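/- Let $\mathbb{K}$ be a commutative ring and let $A = \bigoplus_{i \in \mathbb{Z}} A^i$ be a DG $\mathbb{K}$-algebra (associative and unital, not necessarily commutative). For left DG $A$-modules $M, N$ let $\operatorname{Hom}_A(M,N) = \bigoplus_{i\in\mathbb{Z}} \operatorname{Hom}^i_A(M,N)$ be the DG $\mathbb{K}$-module whose degree $i$ part consists of the $\mathbb{K}$-linear maps $f : M \to N$ of degree $i$ with $f(am) = (-1)^{ij} a f(m)$ for $a \in A^j$, $m \in M$, with differential $f \mapsto d_N \circ f - (-1)^i f \circ d_M$ on $\operatorname{Hom}^i_A(M,N)$; and let $\operatorname{End}_A(M) := \operatorname{Hom}_A(M,M)$, a DG $\mathbb{K}$-algebra under composition, over which $M$ is a left DG module by evaluation. A DG $A$-module $P$ is K-projective if $\operatorname{Hom}_A(P,N)$ is acyclic for every acyclic DG $A$-module $N$; a K-projective resolution of $M$ is a quasi-isomorphism $P \to M$ of DG $A$-modules with $P$ K-projective. Proposition. Let $M$ be a left DG $A$-module, and let $P \to M$ and $P' \to M$ be K-projective resolutions. Put $B := \operatorname{End}_A(P)$ and $B' := \operatorname{End}_A(P')$. Then there exist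 a DG $\mathbb{K}$-algebra $B''$, a left DG $B''$-module $P''$, DG $\mathbb{K}$-algebra quasi-isomorphisms $B'' \to B$ and $B'' \to B'$, and DG $B''$-module quasi-isomorphisms $P'' \to P$ and $P'' \to P'$, where $P$ and $P'$ are regarded as DG $B''$-modules by restriction along $B'' \to B$ and $B'' \to B'$ respectively. -/

import Mathlib

open scoped DirectSum

universe u v w w'

/-! DG modules over a commutative ring `K`, their cohomology and quasi-isomorphisms. -/

/-- A DG `K`-module `X = ⨁ Xⁱ` (a cochain complex of `K`-modules), with its grading given by
submodules of the total space and a differential of degree `1`. -/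
structure DGComplex (K : Type u) [CommRing K] where
  carrier : Type w
  [addCommGroup : AddCommGroup carrier]
  [module : Module K carrier]
  grading : ℤ → Submodule K carrier
  isInternal : DirectSum.IsInternal grading
  d : carrier →ₗ[K] carrier
  d_mem : ∀ (i : ℤ) (x : carrier), x ∈ grading i → d x ∈ grading (i + 1)
  d_d : ∀ x : carrier, d (d x) = 0

namespace DGComplex

attribute [instance] DGComplex.addCommGroup DGComplex.module

variable {K : Type u} [CommRing K]

/-- A homomorphism of DG `K`-modules: linear of degree `0`, commuting with the differentials. -/
structure Hom (X : DGComplex.{u, w} K) (Y : DGComplex.{u, w'} K) extends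
    X.carrier →ₗ[K] Y.carrier where
  map_mem : ∀ (i : ℤ) (x : X.carrier), x ∈ X.grading i → toLinearMap x ∈ Y.grading i
  map_d : ∀ x : X.carrier, toLinearMap (X.d x) = Y.d (toLinearMap x)

/-- The cocycles. -/
def cocycles (X : DGComplex.{u, w} K) : Submodule K X.carrier := LinearMap.ker X.d

/-- The coboundaries, as a submodule of the cocycles. -/
def coboundaries (X : DGComplex.{u, w} K) : Submodule K X.cocycles :=
  (LinearMap.range X.d).submoduleOf X.cocycles

/-- The total cohomology `H(X) = ⨁ Hⁱ(X)`, that is, cocycles modulo coboundaries. -/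
abbrev cohomology (X : DGComplex.{u, w} K) : Type w := X.cocycles ⧸ X.coboundaries

/-- The map on cocycles induced by a homomorphism. -/
def Hom.cocyclesMap {X : DGComplex.{u, w} K} {Y : DGComplex.{u, w'} K} (f : Hom X Y) :
    X.cocycles →ₗ[K] Y.cocycles :=
  f.toLinearMap.restrict (fun x hx => by
    change Y.d (f.toLinearMap x) = 0
    rw [← f.map_d, show X.d x = 0 from hx, map_zero])

/-- The map `H(f) : H(X) → H(Y)` induced by a homomorphism. -/
def Hom.cohomologyMap {X : DGComplex.{u, w} K} {Y : DGComplex.{u, w'} K} (f : Hom X Y) :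
    X.cohomology →ₗ[K] Y.cohomology :=
  Submodule.mapQ X.coboundaries Y.coboundaries f.cocyclesMap (by
    rintro ⟨x, hx⟩ ⟨y, hy⟩
    exact ⟨f.toLinearMap y, by rw [← f.map_d, hy]; rfl⟩)

/-- A quasi-isomorphism: a homomorphism inducing an isomorphism on cohomology. -/
def Hom.IsQuasiIso {X : DGComplex.{u, w} K} {Y : DGComplex.{u, w'} K} (f : Hom X Y) : Prop :=
  Function.Bijective f.cohomologyMap

/-- An acyclic DG module: its cohomology vanishes. -/
def IsAcyclic (X : DGComplex.{u, w} K) : Prop := Subsingleton X.cohomology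

/-- The linear automorphism `x ↦ (-1)ⁱ x` for `x` of degree `i`. -/
noncomputable def sign (X : DGComplex.{u, w} K) : X.carrier →ₗ[K] X.carrier :=
  (DirectSum.toModule K ℤ X.carrier (fun i => i.negOnePow • (X.grading i).subtype)) ∘ₗ
    (LinearEquiv.ofBijective (DirectSum.coeLinearMap X.grading) X.isInternal).symm.toLinearMap

theorem sign_of_mem (X : DGComplex.{u, w} K) {i : ℤ} {x : X.carrier} (hx : x ∈ X.grading i) :
    X.sign x = i.negOnePow • x := by
  have h : (LinearEquiv.ofBijective (DirectSum.coeLinearMap X.grading) X.isInternal).symm x =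
      DirectSum.lof K ℤ (fun i => X.grading i) i ⟨x, hx⟩ := by
    rw [LinearEquiv.symm_apply_eq]
    exact (DirectSum.coeLinearMap_lof X.grading i ⟨x, hx⟩).symm
  simp only [sign, LinearMap.comp_apply, LinearEquiv.coe_coe, h, DirectSum.toModule_lof]
  rfl

/-- Induction on homogeneous elements. -/
theorem induction (X : DGComplex.{u, w} K) {p : X.carrier → Prop}
    (mem : ∀ (i : ℤ) (x : X.carrier), x ∈ X.grading i → p x) (zero : p 0)
    (add : ∀ x y, p x → p y → p (x + y)) (x : X.carrier) : p x := by
  have hx : x ∈ ⨆ i, X.grading i := by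
    rw [X.isInternal.submodule_iSup_eq_top]; trivial
  exact Submodule.iSup_induction X.grading (motive := p) hx mem zero add

theorem sign_sign (X : DGComplex.{u, w} K) (x : X.carrier) : X.sign (X.sign x) = x := by
  refine X.induction (p := fun x => X.sign (X.sign x) = x) (fun i x hx => ?_) (by simp)
    (fun x y hx hy => by rw [map_add, map_add, hx, hy]) x
  rcases Int.units_eq_one_or i.negOnePow with h | h <;>
  simp [X.sign_of_mem hx, h, Units.neg_smul]

end DGComplex

/-! DG algebras. -/

/-- A DG `K`-algebra `A = ⨁ Aⁱ` (associative and unital, not necessarily commutative). -/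
structure DGAlgebra (K : Type u) [CommRing K] where
  carrier : Type v
  [ring : Ring carrier]
  [algebra : Algebra K carrier]
  grading : ℤ → Submodule K carrier
  [gradedMonoid : SetLike.GradedMonoid grading]
  isInternal : DirectSum.IsInternal grading
  d : carrier →ₗ[K] carrier
  d_mem : ∀ (i : ℤ) (a : carrier), a ∈ grading i → d a ∈ grading (i + 1)
  d_d : ∀ a : carrier, d (d a) = 0
  d_mul : ∀ (i : ℤ) (a b : carrier), a ∈ grading i →
    d (a * b) = d a * b + i.negOnePow • (a * d b)

namespace DGAlgebra

attribute [instance] DGAlgebra.ring DGAlgebra.algebra DGAlgebra.gradedMonoid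

variable {K : Type u} [CommRing K]

/-- The underlying DG `K`-module of a DG algebra. -/
def toDGComplex (A : DGAlgebra.{u, v} K) : DGComplex.{u, v} K where
  carrier := A.carrier
  grading := A.grading
  isInternal := A.isInternal
  d := A.d
  d_mem := A.d_mem
  d_d := A.d_d

/-- A homomorphism of DG `K`-algebras: a unital `K`-algebra homomorphism of degree `0`,
commuting with the differentials. -/
structure Hom (A : DGAlgebra.{u, v} K) (B : DGAlgebra.{u, w} K) extends
    A.carrier →ₐ[K] B.carrier where
  map_mem : ∀ (i : ℤ) (a : A.carrier), a ∈ A.grading i → toAlgHom a ∈ B.grading i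
  map_d : ∀ a : A.carrier, toAlgHom (A.d a) = B.d (toAlgHom a)

/-- The underlying homomorphism of DG `K`-modules. -/
def Hom.toDGComplexHom {A : DGAlgebra.{u, v} K} {B : DGAlgebra.{u, w} K} (f : Hom A B) :
    DGComplex.Hom A.toDGComplex B.toDGComplex where
  toLinearMap := f.toAlgHom.toLinearMap
  map_mem := f.map_mem
  map_d := f.map_d

/-- A DG algebra quasi-isomorphism. -/
def Hom.IsQuasiIso {A : DGAlgebra.{u, v} K} {B : DGAlgebra.{u, w} K} (f : Hom A B) : Prop :=
  f.toDGComplexHom.IsQuasiIso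

end DGAlgebra

/-! DG modules over a DG algebra. -/

/-- A left DG module `M = ⨁ Mⁱ` over the DG `K`-algebra `A`. -/
structure DGModule {K : Type u} [CommRing K] (A : DGAlgebra.{u, v} K) extends
    DGComplex.{u, w} K where
  [moduleA : Module A.carrier carrier]
  [isScalarTower : IsScalarTower K A.carrier carrier]
  smul_mem : ∀ (i j : ℤ) (a : A.carrier) (m : carrier),
    a ∈ A.grading i → m ∈ grading j → a • m ∈ grading (i + j)
  d_smul : ∀ (i : ℤ) (a : A.carrier) (m : carrier), a ∈ A.grading i →
    d (a • m) = A.d a • m + i.negOnePow • (a • d m)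

namespace DGModule

attribute [instance] DGModule.moduleA DGModule.isScalarTower

variable {K : Type u} [CommRing K] {A : DGAlgebra.{u, v} K}

/-- A homomorphism of DG `A`-modules: `A`-linear of degree `0`, commuting with the
differentials. -/
structure Hom (M : DGModule.{u, v, w} A) (N : DGModule.{u, v, w'} A) extends
    M.carrier →ₗ[A.carrier] N.carrier where
  map_mem : ∀ (i : ℤ) (m : M.carrier), m ∈ M.grading i → toLinearMap m ∈ N.grading i
  map_d : ∀ m : M.carrier, toLinearMap (M.d m) = N.d (toLinearMap m)

/-- The underlying homomorphism of DG `K`-modules. -/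
def Hom.toDGComplexHom {M : DGModule.{u, v, w} A} {N : DGModule.{u, v, w'} A} (f : Hom M N) :
    DGComplex.Hom M.toDGComplex N.toDGComplex where
  toLinearMap := f.toLinearMap.restrictScalars K
  map_mem := f.map_mem
  map_d := f.map_d

/-- A DG module quasi-isomorphism. -/
def Hom.IsQuasiIso {M : DGModule.{u, v, w} A} {N : DGModule.{u, v, w'} A} (f : Hom M N) : Prop :=
  f.toDGComplexHom.IsQuasiIso

/-- Restriction of scalars along a homomorphism `f : A → B` of DG algebras: the same DG `K`-module
with `a • n = f a • n`. -/
@[reducible] def restrict {B : DGAlgebra.{u, w'} K} (f : DGAlgebra.Hom A B)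
    (N : DGModule.{u, w', w} B) : DGModule.{u, v, w} A :=
  letI : Module A.carrier N.carrier := Module.compHom N.carrier f.toAlgHom.toRingHom
  { toDGComplex := N.toDGComplex
    isScalarTower := ⟨fun k a n => by
      change f.toAlgHom (k • a) • n = k • (f.toAlgHom a • n)
      rw [map_smul, smul_assoc]⟩
    smul_mem := fun i j a n ha hn => N.smul_mem i j _ n (f.map_mem i a ha) hn
    d_smul := fun i a n ha => by
      change N.d (f.toAlgHom a • n) = f.toAlgHom (A.d a) • n + i.negOnePow • (f.toAlgHom a • N.d n)
      rw [f.map_d]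
      exact N.d_smul i _ n (f.map_mem i a ha) }

/-- `Homⁱ_A(M, N)`: the `A`-linear homomorphisms of degree `i`, where linearity of a homomorphism
of degree `i` means `f (a m) = (-1) ^ (i j) a f(m)` for `a` of degree `j`. -/
def homDeg (M : DGModule.{u, v, w} A) (N : DGModule.{u, v, w'} A) (i : ℤ) :
    Submodule K (M.carrier →ₗ[K] N.carrier) where
  carrier := {f | (∀ (j : ℤ) (m : M.carrier), m ∈ M.grading j → f m ∈ N.grading (i + j)) ∧
    ∀ (j : ℤ) (a : A.carrier) (m : M.carrier), a ∈ A.grading j →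
      f (a • m) = (i * j).negOnePow • (a • f m)}
  add_mem' := by
    rintro f g ⟨hf, hf'⟩ ⟨hg, hg'⟩
    refine ⟨fun j m hm => add_mem (hf j m hm) (hg j m hm), fun j a m ha => ?_⟩
    simp only [LinearMap.add_apply, hf' j a m ha, hg' j a m ha, smul_add]
  zero_mem' := ⟨fun j m _ => zero_mem _, fun j a m _ => by simp⟩
  smul_mem' := by
    rintro k f ⟨hf, hf'⟩
    refine ⟨fun j m hm => Submodule.smul_mem _ k (hf j m hm), fun j a m ha => ?_⟩
    rw [LinearMap.smul_apply, LinearMap.smul_apply, hf' j a m ha, smul_comm k, smul_algebra_smul_comm]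

/-- The underlying `K`-module of `Hom_A(M, N)`: the sum (which is direct, by `homDeg_iSupIndep`)
of the `Homⁱ_A(M, N)` over all integers `i`, taken inside the `K`-linear maps. -/
def homTotal (M : DGModule.{u, v, w} A) (N : DGModule.{u, v, w'} A) :
    Submodule K (M.carrier →ₗ[K] N.carrier) :=
  ⨆ i, homDeg M N i

theorem homDeg_iSupIndep (M : DGModule.{u, v, w} A) (N : DGModule.{u, v, w'} A) :
    iSupIndep (homDeg M N) := by
  rw [iSupIndep_iff_finsetSum_eq_zero_imp_eq_zero]
  intro s f hf h0 i hi
  ext m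
  refine M.toDGComplex.induction (p := fun m => f i m = 0) (fun j m hm => ?_) (map_zero _)
    (fun x y hx hy => ?_) m
  · have hN := N.isInternal.submodule_iSupIndep.comp (f := fun i : ℤ => i + j)
      (add_left_injective j)
    rw [iSupIndep_iff_finsetSum_eq_zero_imp_eq_zero] at hN
    refine hN s (fun i => f i m) (fun i hi => (hf i hi).1 j m hm) ?_ i hi
    rw [← LinearMap.sum_apply, h0, LinearMap.zero_apply]
  · rw [map_add, hx, hy, add_zero]

/-- The pieces of an independent family of submodules form an internal grading of their sum. -/
theorem isInternal_comap {V : Type w} [AddCommGroup V] [Module K V]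
    (G : ℤ → Submodule K V) (hG : iSupIndep G) (S : Submodule K V) (hS : S = ⨆ i, G i) :
    DirectSum.IsInternal (fun i => (G i).comap S.subtype) := by
  refine (DirectSum.isInternal_submodule_iff_iSupIndep_and_iSup_eq_top _).2 ⟨?_, ?_⟩
  · rw [iSupIndep_iff_finsetSum_eq_zero_imp_eq_zero] at hG ⊢
    intro s x hx h0 i hi
    refine Subtype.ext (hG s (fun i => (x i : V)) hx ?_ i hi)
    rw [← Submodule.coe_sum, h0, Submodule.coe_zero]
  · apply Submodule.map_injective_of_injective S.injective_subtype
    rw [Submodule.map_iSup, Submodule.map_subtype_top]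
    conv_rhs => rw [hS]
    refine iSup_congr fun i => ?_
    rw [Submodule.map_comap_subtype, inf_eq_right, hS]
    exact le_iSup G i

/-- The differential `f ↦ d_N ∘ f - (-1)ⁱ f ∘ d_M` (for `f` of degree `i`; see `homD_of_mem`),
written for all `f` at once: `sign ∘ f ∘ sign` equals `(-1)ⁱ f` when `f` has degree `i`. -/
noncomputable def homD (M : DGModule.{u, v, w} A) (N : DGModule.{u, v, w'} A) :
    (M.carrier →ₗ[K] N.carrier) →ₗ[K] (M.carrier →ₗ[K] N.carrier) :=
  LinearMap.llcomp K M.carrier N.carrier N.carrier N.d -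
    LinearMap.llcomp K M.carrier N.carrier N.carrier N.sign ∘ₗ
      LinearMap.lcomp K N.carrier (M.sign ∘ₗ M.d)

theorem homD_apply (M : DGModule.{u, v, w} A) (N : DGModule.{u, v, w'} A)
    (f : M.carrier →ₗ[K] N.carrier) (m : M.carrier) :
    homD M N f m = N.d (f m) - N.sign (f (M.sign (M.d m))) := rfl

theorem sign_conj (M : DGModule.{u, v, w} A) (N : DGModule.{u, v, w'} A) {i : ℤ}
    {f : M.carrier →ₗ[K] N.carrier} (hf : f ∈ homDeg M N i) (m : M.carrier) :
    N.sign (f (M.sign m)) = i.negOnePow • f m := by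
  refine M.toDGComplex.induction (p := fun m => N.sign (f (M.sign m)) = i.negOnePow • f m)
    (fun j m hm => ?_) (by simp) (fun x y hx hy => ?_) m
  · rw [M.sign_of_mem hm, N.sign_of_mem (i := i + j), Int.negOnePow_add]
    · rcases Int.units_eq_one_or j.negOnePow with h | h <;>
      rcases Int.units_eq_one_or i.negOnePow with h' | h' <;> simp [h, h', Units.neg_smul]
    · rcases Int.units_eq_one_or j.negOnePow with h | h <;> simp [h, Units.neg_smul, hf.1 j m hm]
  · simp only [map_add, smul_add, hx, hy]

theorem homD_of_mem (M : DGModule.{u, v, w} A) (N : DGModule.{u, v, w'} A) {i : ℤ}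
    {f : M.carrier →ₗ[K] N.carrier} (hf : f ∈ homDeg M N i) (m : M.carrier) :
    homD M N f m = N.d (f m) - i.negOnePow • f (M.d m) := by
  rw [homD_apply, sign_conj M N hf]

theorem homD_mem (M : DGModule.{u, v, w} A) (N : DGModule.{u, v, w'} A) {i : ℤ}
    {f : M.carrier →ₗ[K] N.carrier} (hf : f ∈ homDeg M N i) :
    homD M N f ∈ homDeg M N (i + 1) := by
  refine ⟨fun j m hm => ?_, fun j a m ha => ?_⟩
  · rw [homD_of_mem M N hf]
    have h1 := N.d_mem _ _ (hf.1 j m hm)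
    have h2 := hf.1 _ _ (M.d_mem _ _ hm)
    rw [show i + j + 1 = i + 1 + j by ring] at h1
    rw [show i + (j + 1) = i + 1 + j by ring] at h2
    rcases Int.units_eq_one_or i.negOnePow with h | h <;> rw [h]
    · rw [one_smul]; exact sub_mem h1 h2
    · rw [Units.neg_smul, one_smul]; exact sub_mem h1 (neg_mem h2)
  · have hd := A.d_mem _ _ ha
    rw [homD_of_mem M N hf, homD_of_mem M N hf, hf.2 j a m ha, M.d_smul j a m ha, map_add,
      hf.2 _ _ m hd, show i * (j + 1) = i * j + i by ring, show (i + 1) * j = i * j + j by ring,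
      Int.negOnePow_add, Int.negOnePow_add]
    have e := hf.2 j a (M.d m) ha
    have e' := N.d_smul j a (f m) ha
    rcases Int.units_eq_one_or i.negOnePow with h | h <;>
    rcases Int.units_eq_one_or j.negOnePow with h' | h' <;>
    rcases Int.units_eq_one_or (i * j).negOnePow with h'' | h'' <;>
    simp only [h, h', h'', one_smul, Units.neg_smul, map_neg, mul_one, mul_neg, neg_neg,
      smul_sub, smul_neg, smul_add] at e e' ⊢ <;> rw [e, e'] <;> abel

theorem homD_mem_homTotal (M : DGModule.{u, v, w} A) (N : DGModule.{u, v, w'} A)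
    (f : M.carrier →ₗ[K] N.carrier) (hf : f ∈ homTotal M N) : homD M N f ∈ homTotal M N := by
  refine Submodule.iSup_induction (homDeg M N) (motive := fun f => homD M N f ∈ homTotal M N) hf
    (fun i f hf => ?_) ?_ (fun f g hf hg => ?_)
  · exact Submodule.mem_iSup_of_mem (i + 1) (homD_mem M N hf)
  · rw [map_zero]; exact zero_mem _
  · rw [map_add]; exact add_mem hf hg

theorem homD_homD (M : DGModule.{u, v, w} A) (N : DGModule.{u, v, w'} A)
    (f : M.carrier →ₗ[K] N.carrier) (hf : f ∈ homTotal M N) : homD M N (homD M N f) = 0 := by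
  refine Submodule.iSup_induction (homDeg M N) (motive := fun f => homD M N (homD M N f) = 0) hf
    (fun i f hf => ?_) (by simp) (fun f g hf hg => by rw [map_add, map_add, hf, hg, add_zero])
  ext m
  rw [homD_of_mem M N (homD_mem M N hf), homD_of_mem M N hf, homD_of_mem M N hf, M.d_d, map_sub,
    N.d_d, Int.negOnePow_succ]
  rcases Int.units_eq_one_or i.negOnePow with h | h <;> simp [h, Units.neg_smul]

/-- The DG `K`-module `Hom_A(M, N) = ⨁ Homⁱ_A(M, N)`. -/
noncomputable def homComplex (M : DGModule.{u, v, w} A) (N : DGModule.{u, v, w'} A) :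
    DGComplex.{u, max w w'} K where
  carrier := homTotal M N
  grading i := (homDeg M N i).comap (homTotal M N).subtype
  isInternal := isInternal_comap (homDeg M N) (homDeg_iSupIndep M N) (homTotal M N) rfl
  d := (homD M N).restrict (homD_mem_homTotal M N)
  d_mem _ _ hf := homD_mem M N hf
  d_d f := Subtype.ext (homD_homD M N f.1 f.2)

theorem one_mem_homDeg (M : DGModule.{u, v, w} A) :
    (1 : Module.End K M.carrier) ∈ homDeg M M 0 :=
  ⟨fun j m hm => by simpa using hm, fun j a m _ => by simp⟩

theorem mul_mem_homDeg (M : DGModule.{u, v, w} A) {i j : ℤ} {f g : Module.End K M.carrier}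
    (hf : f ∈ homDeg M M i) (hg : g ∈ homDeg M M j) : f * g ∈ homDeg M M (i + j) := by
  refine ⟨fun l m hm => ?_, fun l a m ha => ?_⟩
  · rw [add_assoc]
    exact hf.1 _ _ (hg.1 l m hm)
  · have e := hf.2 l a (g m) ha
    rw [Module.End.mul_apply, Module.End.mul_apply, hg.2 l a m ha, add_mul, Int.negOnePow_add]
    rcases Int.units_eq_one_or (i * l).negOnePow with h | h <;>
    rcases Int.units_eq_one_or (j * l).negOnePow with h' | h' <;>
    simp only [h, h', Units.neg_smul, one_smul, map_neg, mul_one, mul_neg, neg_neg] at e ⊢ <;>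
    simp only [e, neg_neg]

theorem homD_comp (M : DGModule.{u, v, w} A) {i : ℤ} {f : M.carrier →ₗ[K] M.carrier}
    (hf : f ∈ homDeg M M i) (g : M.carrier →ₗ[K] M.carrier) :
    homD M M (f ∘ₗ g) = homD M M f ∘ₗ g + i.negOnePow • (f ∘ₗ homD M M g) := by
  ext m
  have e := sign_conj M M hf (M.sign (g (M.sign (M.d m))))
  rw [M.sign_sign] at e
  have h2 : homD M M g m = M.d (g m) - M.sign (g (M.sign (M.d m))) := rfl
  change homD M M (f ∘ₗ g) m = homD M M f (g m) + i.negOnePow • f (homD M M g m)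
  rw [homD_of_mem M M hf, h2, homD_apply, LinearMap.comp_apply, LinearMap.comp_apply, e,
    map_sub f, smul_sub]
  abel

/-- The underlying `K`-algebra of `End_A(M)`: same elements as `homTotal M M`, multiplied by
composition. -/
def endSubalgebra (M : DGModule.{u, v, w} A) : Subalgebra K (Module.End K M.carrier) :=
  (homTotal M M).toSubalgebra (Submodule.mem_iSup_of_mem 0 (one_mem_homDeg M)) (by
    intro f g hf hg
    refine Submodule.iSup_induction (homDeg M M) (motive := fun f => f * g ∈ homTotal M M) hf
      (fun i f hf => ?_) ?_ (fun f f' hf hf' => ?_)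
    · refine Submodule.iSup_induction (homDeg M M) (motive := fun g => f * g ∈ homTotal M M) hg
        (fun j g hg => ?_) ?_ (fun g g' hg hg' => ?_)
      · exact Submodule.mem_iSup_of_mem (i + j) (mul_mem_homDeg M hf hg)
      · rw [mul_zero]; exact zero_mem _
      · rw [mul_add]; exact add_mem hg hg'
    · rw [zero_mul]; exact zero_mem _
    · rw [add_mul]; exact add_mem hf hf')

/-- The DG `K`-algebra `End_A(M) = Hom_A(M, M)`, with composition as multiplication. -/
noncomputable def endAlgebra (M : DGModule.{u, v, w} A) : DGAlgebra.{u, w} K where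
  carrier := endSubalgebra M
  grading i := (homDeg M M i).comap (endSubalgebra M).val.toLinearMap
  gradedMonoid :=
    { one_mem := one_mem_homDeg M
      mul_mem := fun _ _ _ _ hf hg => mul_mem_homDeg M hf hg }
  isInternal := (homComplex M M).isInternal
  d := (homComplex M M).d
  d_mem := (homComplex M M).d_mem
  d_d := (homComplex M M).d_d
  d_mul _ _ g hf := Subtype.ext (homD_comp M hf g.1)

/-- The DG `K`-module `M` as a left DG module over `End_A(M)`, acting by evaluation. -/
noncomputable def overEnd (M : DGModule.{u, v, w} A) : DGModule.{u, w, w} (endAlgebra M) where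
  toDGComplex := M.toDGComplex
  moduleA := inferInstanceAs (Module (endSubalgebra M) M.carrier)
  isScalarTower := inferInstanceAs (IsScalarTower K (endSubalgebra M) M.carrier)
  smul_mem i j f m hf hm := hf.1 j m hm
  d_smul i f m hf := by
    have e := homD_of_mem M M hf m
    change M.d (f.1 m) = homD M M f.1 m + i.negOnePow • f.1 (M.d m)
    exact (congrArg (fun x => x + i.negOnePow • f.1 (M.d m)) e |>.trans (sub_add_cancel _ _)).symm

/-- A DG `A`-module `P` is K-projective if `Hom_A(P, N)` is acyclic for every acyclic
DG `A`-module `N`. -/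
def IsKProjective (P : DGModule.{u, v, w} A) : Prop :=
  ∀ N : DGModule.{u, v, w} A, N.toDGComplex.IsAcyclic → (homComplex P N).IsAcyclic

end DGModule

universe w''

/-!
Lifting `P → M` along `P' → M` gives a quasi-isomorphism `φ : P → P'`. Its cocone `C = P'[-1] ⊕ P`
is acyclic and K-projective, so `Hom_A(C, -)` and `Hom_A(P, C)` are acyclic. Let `B''` consist of
the endomorphisms of `C` preserving `P'[-1]`. The two diagonal entries are surjective homomorphisms
`B'' → End_A(P)` and `B'' → End_A(P'[-1]) ≅ End_A(P')` with kernels `Hom_A(C, P'[-1])` and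
`Hom_A(P, C)`, so both are quasi-isomorphisms.

Neither `P` nor `P'` maps to the other over `B''`, but `P'[-1] ⊆ C` is a DG submodule over `B''`
with quotient `P`. So let `P''` be `C ⊕ P'` with the differential twisted by `P' → P'[-1] ⊆ C`. The
kernel of `P'' → P'` is the acyclic `C`, and that of `P'' → P` is the cone of an identity map.
-/

theorem negOnePow_smul_mem {V S : Type*} [AddCommGroup V] [SetLike S V] [AddSubgroupClass S V]
    {s : S} (i : ℤ) {x : V} (hx : x ∈ s) : i.negOnePow • x ∈ s := by
  rw [Units.smul_def]
  exact zsmul_mem hx _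

theorem map_negOnePow_smul {V W F : Type*} [AddCommGroup V] [AddCommGroup W] [FunLike F V W]
    [AddMonoidHomClass F V W] (f : F) (i : ℤ) (x : V) :
    f (i.negOnePow • x) = i.negOnePow • f x := by
  simp only [Units.smul_def, map_zsmul]

theorem negOnePow_smul_smul_self {V : Type*} [AddCommGroup V] (i : ℤ) (x : V) :
    i.negOnePow • i.negOnePow • x = x := by
  rw [smul_smul, Int.units_mul_self, one_smul]

theorem isInternal_prod {ι R V W : Type*} [DecidableEq ι] [Ring R] [AddCommGroup V]
    [AddCommGroup W] [Module R V] [Module R W] {G : ι → Submodule R V} {H : ι → Submodule R W}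
    (hG : DirectSum.IsInternal G) (hH : DirectSum.IsInternal H) :
    DirectSum.IsInternal fun i => (G i).prod (H i) := by
  rw [DirectSum.isInternal_submodule_iff_iSupIndep_and_iSup_eq_top,
    iSupIndep_iff_finsetSum_eq_zero_imp_eq_zero] at hG hH ⊢
  refine ⟨fun s x hx h0 i hi => ?_, ?_⟩
  · rw [Prod.ext_iff, Prod.fst_sum, Prod.snd_sum] at h0
    exact Prod.ext (hG.1 s _ (fun j hj => (hx j hj).1) h0.1 i hi)
      (hH.1 s _ (fun j hj => (hx j hj).2) h0.2 i hi)
  · simp only [LinearMap.prod_eq_sup_map]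
    rw [iSup_sup_eq, ← Submodule.map_iSup, ← Submodule.map_iSup, hG.2, hH.2,
      ← LinearMap.prod_eq_sup_map, Submodule.prod_top]

namespace DGComplex

variable {K : Type u} [CommRing K]

section Component

variable (X : DGComplex.{u, w} K)

/-- The projection of `X = ⨁ Xⁱ` onto `Xⁱ`, as an endomorphism of the total space. -/
noncomputable def component (i : ℤ) : X.carrier →ₗ[K] X.carrier :=
  (X.grading i).subtype ∘ₗ DirectSum.component K ℤ (fun i => X.grading i) i ∘ₗ
    (LinearEquiv.ofBijective (DirectSum.coeLinearMap X.grading) X.isInternal).symm.toLinearMap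

theorem component_mem (i : ℤ) (x : X.carrier) : X.component i x ∈ X.grading i :=
  Subtype.property _

theorem component_of_mem (j : ℤ) {i : ℤ} {x : X.carrier} (hx : x ∈ X.grading i) :
    X.component j x = if i = j then x else 0 := by
  have hx' : (LinearEquiv.ofBijective (DirectSum.coeLinearMap X.grading) X.isInternal).symm x =
      DirectSum.lof K ℤ (fun i => X.grading i) i ⟨x, hx⟩ := by
    rw [LinearEquiv.symm_apply_eq]
    exact (DirectSum.coeLinearMap_lof X.grading i ⟨x, hx⟩).symm
  simp only [component, LinearMap.comp_apply, LinearEquiv.coe_coe, hx', Submodule.subtype_apply]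
  split_ifs with h
  · subst h
    rw [DirectSum.component.lof_self]
  · rw [DirectSum.component.of, dif_neg h, Submodule.coe_zero]

variable {X}

theorem mem_of_component_mem {S : Submodule K X.carrier} {x : X.carrier}
    (h : ∀ i, X.component i x ∈ S) : x ∈ S := by
  let e := LinearEquiv.ofBijective (DirectSum.coeLinearMap X.grading) X.isInternal
  have hx : DirectSum.coeLinearMap X.grading (e.symm x) = x := e.apply_symm_apply x
  classical
  rw [← hx, DirectSum.coeLinearMap_eq_dfinsuppSum]
  exact Submodule.dfinsuppSum_mem _ _ _ fun i _ => h i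

theorem map_component {Y : DGComplex.{u, w'} K} (f : X.carrier →ₗ[K] Y.carrier) (n : ℤ)
    (hf : ∀ i, ∀ x ∈ X.grading i, f x ∈ Y.grading (i + n)) (i : ℤ) (x : X.carrier) :
    f (X.component i x) = Y.component (i + n) (f x) := by
  refine X.induction (p := fun x => f (X.component i x) = Y.component (i + n) (f x))
    (fun j x hx => ?_) (by simp only [map_zero])
    (fun x y hx hy => by simp only [map_add, hx, hy]) x
  rw [X.component_of_mem i hx, Y.component_of_mem (i + n) (hf j x hx), apply_ite f, map_zero]
  simp only [add_left_inj]

theorem exists_mem_grading_d_eq {i : ℤ} {x : X.carrier} (hx : X.d x ∈ X.grading (i + 1)) :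
    ∃ y ∈ X.grading i, X.d y = X.d x :=
  ⟨X.component i x, X.component_mem i x, by
    rw [map_component X.d 1 X.d_mem, X.component_of_mem _ hx, if_pos rfl]⟩

end Component

theorem sign_d (X : DGComplex.{u, w} K) (x : X.carrier) : X.sign (X.d x) = -X.d (X.sign x) := by
  refine X.induction (p := fun x => X.sign (X.d x) = -X.d (X.sign x))
    (fun i x hx => ?_) (by simp only [map_zero, neg_zero])
    (fun x y hx hy => by simp only [map_add, neg_add, hx, hy]) x
  rw [X.sign_of_mem hx, X.sign_of_mem (X.d_mem i x hx), map_negOnePow_smul, Int.negOnePow_succ,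
    Units.neg_smul]

theorem isAcyclic_iff {X : DGComplex.{u, w} K} :
    X.IsAcyclic ↔ ∀ x, X.d x = 0 → ∃ y, X.d y = x := by
  rw [IsAcyclic, Submodule.Quotient.subsingleton_iff, Submodule.eq_top_iff']
  exact ⟨fun h x hx => h ⟨x, hx⟩, fun h x => h x.1 x.2⟩

namespace Hom

variable {X : DGComplex.{u, w} K} {Y : DGComplex.{u, w'} K} {Z : DGComplex.{u, w''} K}

theorem isQuasiIso_iff (f : Hom X Y) : f.IsQuasiIso ↔
    (∀ x, X.d x = 0 → ∀ y, f.toLinearMap x = Y.d y → ∃ x', X.d x' = x) ∧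
      ∀ y, Y.d y = 0 → ∃ x, X.d x = 0 ∧ ∃ y', f.toLinearMap x - y = Y.d y' := by
  have cohomologyMap_mk (x : X.cocycles) : f.cohomologyMap (Submodule.Quotient.mk x) =
      Submodule.Quotient.mk (f.cocyclesMap x) := rfl
  refine and_congr ?_ ?_
  · rw [injective_iff_map_eq_zero, (Submodule.Quotient.mk_surjective _).forall]
    simp only [cohomologyMap_mk, Submodule.Quotient.mk_eq_zero]
    exact ⟨fun h x hx y hy => h ⟨x, hx⟩ ⟨y, hy.symm⟩,
      fun h x ⟨y, hy⟩ => h x.1 x.2 y hy.symm⟩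
  · rw [Function.Surjective, (Submodule.Quotient.mk_surjective _).forall]
    simp only [(Submodule.Quotient.mk_surjective _).exists, cohomologyMap_mk,
      Submodule.Quotient.eq]
    exact ⟨fun h y hy => (h ⟨y, hy⟩).imp' Subtype.val fun x ⟨y', hy'⟩ => ⟨x.2, y', hy'.symm⟩,
      fun h y => (h y.1 y.2).elim fun x ⟨hx, y', hy'⟩ => ⟨⟨x, hx⟩, y', hy'.symm⟩⟩

theorem isQuasiIso_of_surjective {f : Hom X Y} (hf : Function.Surjective f.toLinearMap)
    (hker : ∀ x, X.d x = 0 → f.toLinearMap x = 0 → ∃ y, f.toLinearMap y = 0 ∧ X.d y = x) :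
    f.IsQuasiIso := by
  refine (isQuasiIso_iff f).2 ⟨fun x hx y hy => ?_, fun y hy => ?_⟩
  · obtain ⟨x₁, rfl⟩ := hf y
    obtain ⟨x₂, -, hx₂⟩ := hker (x - X.d x₁) (by rw [map_sub, X.d_d, hx, sub_zero])
      (by rw [map_sub, f.map_d, hy, sub_self])
    exact ⟨x₁ + x₂, by rw [map_add, hx₂, add_sub_cancel]⟩
  · obtain ⟨x, rfl⟩ := hf y
    obtain ⟨x₁, hx₁, hd⟩ := hker (X.d x) (X.d_d x) (by rw [f.map_d, hy])
    exact ⟨x - x₁, by rw [map_sub, hd, sub_self], 0,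
      by rw [map_sub, hx₁, map_zero, sub_zero, sub_self]⟩

theorem cohomologyMap_eq_of_sub_mem_range_d {f g : Hom X Y}
    (h : ∀ x, X.d x = 0 → f.toLinearMap x - g.toLinearMap x ∈ LinearMap.range Y.d) :
    f.cohomologyMap = g.cohomologyMap :=
  Submodule.linearMap_qext _ <| LinearMap.ext fun x => (Submodule.Quotient.eq _).2 (h x.1 x.2)

/-- The composite `g ∘ f`. -/
def comp (g : Hom Y Z) (f : Hom X Y) : Hom X Z where
  toLinearMap := g.toLinearMap ∘ₗ f.toLinearMap
  map_mem i x hx := g.map_mem i _ (f.map_mem i x hx)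
  map_d x := (congrArg g.toLinearMap (f.map_d x)).trans (g.map_d _)

theorem cohomologyMap_comp (g : Hom Y Z) (f : Hom X Y) :
    (g.comp f).cohomologyMap = g.cohomologyMap ∘ₗ f.cohomologyMap :=
  Submodule.linearMap_qext _ rfl

theorem IsQuasiIso.comp {g : Hom Y Z} {f : Hom X Y} (hg : g.IsQuasiIso) (hf : f.IsQuasiIso) :
    (g.comp f).IsQuasiIso := by
  rw [IsQuasiIso, cohomologyMap_comp, LinearMap.coe_comp]
  exact Function.Bijective.comp hg hf

end Hom

end DGComplex

namespace DGAlgebra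

variable {K : Type u} [CommRing K]

theorem linearMap_ext {V : Type*} [AddCommGroup V] [Module K V] {A : DGAlgebra.{u, v} K}
    {f g : A.carrier →ₗ[K] V} (h : ∀ i, ∀ a ∈ A.grading i, f a = g a) : f = g :=
  LinearMap.ext fun a => A.toDGComplex.induction (p := fun a => f a = g a) h
    ((map_zero f).trans (map_zero g).symm)
    (fun a b ha hb => (map_add f a b).trans ((congrArg₂ _ ha hb).trans (map_add g a b).symm)) a

/-- The grading involution `a ↦ (-1)ⁱ a`, for `a` of degree `i`, as an algebra endomorphism. -/
noncomputable def signHom (A : DGAlgebra.{u, v} K) : A.carrier →ₐ[K] A.carrier :=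
  let σ : A.carrier →ₗ[K] A.carrier := A.toDGComplex.sign
  have σ_of_mem {i : ℤ} {a : A.carrier} (ha : a ∈ A.grading i) : σ a = i.negOnePow • a :=
    A.toDGComplex.sign_of_mem ha
  have mul_eq : (LinearMap.mul K A.carrier).compr₂ σ = (LinearMap.mul K A.carrier).compl₁₂ σ σ :=
    linearMap_ext fun i a ha => linearMap_ext fun j b hb => by
      simp only [LinearMap.compr₂_apply, LinearMap.compl₁₂_apply, LinearMap.mul_apply']
      rw [σ_of_mem ha, σ_of_mem hb, σ_of_mem (SetLike.GradedMul.mul_mem ha hb),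
        Int.negOnePow_add, smul_mul_smul_comm]
  AlgHom.ofLinearMap σ
    (by rw [σ_of_mem SetLike.GradedOne.one_mem, Int.negOnePow_zero, one_smul])
    fun a b => LinearMap.congr_fun₂ mul_eq a b

theorem signHom_of_mem {A : DGAlgebra.{u, v} K} {i : ℤ} {a : A.carrier} (ha : a ∈ A.grading i) :
    A.signHom a = i.negOnePow • a :=
  A.toDGComplex.sign_of_mem ha

namespace Hom

variable {A : DGAlgebra.{u, v} K} {B : DGAlgebra.{u, w} K} {C : DGAlgebra.{u, w'} K}

/-- The composite `g ∘ f`. -/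
def comp (g : Hom B C) (f : Hom A B) : Hom A C where
  toAlgHom := g.toAlgHom.comp f.toAlgHom
  map_mem i a ha := g.map_mem i _ (f.map_mem i a ha)
  map_d a := (congrArg g.toAlgHom (f.map_d a)).trans (g.map_d _)

theorem IsQuasiIso.comp {g : Hom B C} {f : Hom A B} (hg : g.IsQuasiIso) (hf : f.IsQuasiIso) :
    (g.comp f).IsQuasiIso :=
  DGComplex.Hom.IsQuasiIso.comp (g := g.toDGComplexHom) (f := f.toDGComplexHom) hg hf

end Hom

/-- A subalgebra stable under the homogeneous components and the differential, as a DG algebra. -/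
noncomputable def ofSubalgebra (A : DGAlgebra.{u, v} K) (S : Subalgebra K A.carrier)
    (component_mem : ∀ a ∈ S, ∀ i, (A.toDGComplex.component i a : A.carrier) ∈ S)
    (d_mem : ∀ a ∈ S, A.d a ∈ S) : DGAlgebra.{u, v} K where
  carrier := S
  grading i := (A.grading i).comap S.val.toLinearMap
  gradedMonoid :=
    { one_mem := SetLike.GradedOne.one_mem (A := A.grading)
      mul_mem := fun _ _ _ _ ha hb => SetLike.GradedMul.mul_mem (A := A.grading) ha hb }
  isInternal := by
    have h := DGModule.isInternal_comap (fun i => A.grading i ⊓ S.toSubmodule)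
      (A.isInternal.submodule_iSupIndep.mono fun i => inf_le_left) S.toSubmodule
      (le_antisymm (fun a ha => DGComplex.mem_of_component_mem (X := A.toDGComplex) fun i =>
        Submodule.mem_iSup_of_mem i (Submodule.mem_inf.2
          ⟨A.toDGComplex.component_mem i a, component_mem a ha i⟩))
        (iSup_le fun i => inf_le_right))
    simp only [Submodule.comap_inf, Submodule.comap_subtype_self, inf_top_eq] at h
    exact h
  d := A.d.restrict (p := S.toSubmodule) (q := S.toSubmodule) d_mem
  d_mem i a ha := A.d_mem i a ha
  d_d a := Subtype.ext (A.d_d a)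
  d_mul i a b ha := Subtype.ext (A.d_mul i a b ha)

/-- The inclusion of a DG subalgebra. -/
def ofSubalgebraVal (A : DGAlgebra.{u, v} K) (S : Subalgebra K A.carrier)
    (component_mem : ∀ a ∈ S, ∀ i, (A.toDGComplex.component i a : A.carrier) ∈ S)
    (d_mem : ∀ a ∈ S, A.d a ∈ S) :
    Hom (A.ofSubalgebra S component_mem d_mem) A where
  toAlgHom := S.val
  map_mem _ _ ha := ha
  map_d _ := rfl

end DGAlgebra

namespace DGModule

variable {K : Type u} [CommRing K] {A : DGAlgebra.{u, v} K}

section HomComplex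

variable {M : DGModule.{u, v, w} A} {N : DGModule.{u, v, w'} A} {L : DGModule.{u, v, w''} A}

theorem comp_mem_homDeg {i j : ℤ} {f : N.carrier →ₗ[K] L.carrier} {g : M.carrier →ₗ[K] N.carrier}
    (hf : f ∈ homDeg N L i) (hg : g ∈ homDeg M N j) : f ∘ₗ g ∈ homDeg M L (i + j) := by
  refine ⟨fun l m hm => ?_, fun l a m ha => ?_⟩
  · rw [add_assoc]
    exact hf.1 _ _ (hg.1 l m hm)
  · rw [LinearMap.comp_apply, LinearMap.comp_apply, hg.2 l a m ha, map_negOnePow_smul,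
      hf.2 l a (g m) ha, smul_smul, ← Int.negOnePow_add, add_comm (j * l), add_mul]

theorem comp_mem_homTotal {f : N.carrier →ₗ[K] L.carrier} {g : M.carrier →ₗ[K] N.carrier}
    (hf : f ∈ homTotal N L) (hg : g ∈ homTotal M N) : f ∘ₗ g ∈ homTotal M L := by
  have h : Submodule.map₂ (LinearMap.llcomp K M.carrier N.carrier L.carrier) (homTotal N L)
      (homTotal M N) ≤ homTotal M L := by
    simp only [homTotal, Submodule.map₂_iSup_left, Submodule.map₂_iSup_right, iSup_le_iff,
      Submodule.map₂_le]
    exact fun i j f hf g hg => Submodule.mem_iSup_of_mem _ (comp_mem_homDeg hf hg)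
  exact h (Submodule.apply_mem_map₂ _ hf hg)

theorem mem_homTotal {i : ℤ} {f : M.carrier →ₗ[K] N.carrier} (hf : f ∈ homDeg M N i) :
    f ∈ homTotal M N :=
  Submodule.mem_iSup_of_mem i hf

section SignConj

variable (M N) in
/-- The grading involution `f ↦ (-1)ⁱ f`, for `f` of degree `i`, of `Hom_A(M, N)`. Conjugating by
the involutions of `M` and `N` defines it on all `K`-linear maps, as in `homD`. -/
noncomputable def signConj :
    (M.carrier →ₗ[K] N.carrier) →ₗ[K] (M.carrier →ₗ[K] N.carrier) :=
  LinearMap.llcomp K M.carrier N.carrier N.carrier N.sign ∘ₗ LinearMap.lcomp K N.carrier M.sign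

theorem signConj_apply (f : M.carrier →ₗ[K] N.carrier) (m : M.carrier) :
    signConj M N f m = N.sign (f (M.sign m)) := rfl

theorem signConj_of_mem {i : ℤ} {f : M.carrier →ₗ[K] N.carrier} (hf : f ∈ homDeg M N i) :
    signConj M N f = i.negOnePow • f :=
  LinearMap.ext (sign_conj M N hf)

theorem signConj_of_mem_zero {f : M.carrier →ₗ[K] N.carrier} (hf : f ∈ homDeg M N 0) :
    signConj M N f = f := by
  rw [signConj_of_mem hf, Int.negOnePow_zero, one_smul]

theorem signConj_of_mem_one {f : M.carrier →ₗ[K] N.carrier} (hf : f ∈ homDeg M N 1) :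
    signConj M N f = -f := by
  rw [signConj_of_mem hf, Int.negOnePow_one, Units.neg_smul, one_smul]

theorem signConj_mem_homDeg {i : ℤ} {f : M.carrier →ₗ[K] N.carrier} (hf : f ∈ homDeg M N i) :
    signConj M N f ∈ homDeg M N i := by
  rw [signConj_of_mem hf]
  exact negOnePow_smul_mem i hf

theorem signConj_mem_homTotal {f : M.carrier →ₗ[K] N.carrier} (hf : f ∈ homTotal M N) :
    signConj M N f ∈ homTotal M N :=
  (iSup_le fun _ _ hf => mem_homTotal (signConj_mem_homDeg hf) :
    homTotal M N ≤ (homTotal M N).comap (signConj M N)) hf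

theorem signConj_signConj (f : M.carrier →ₗ[K] N.carrier) :
    signConj M N (signConj M N f) = f :=
  LinearMap.ext fun m => by
    rw [signConj_apply, signConj_apply, M.sign_sign, N.sign_sign]

theorem signConj_comp (f : N.carrier →ₗ[K] L.carrier) (g : M.carrier →ₗ[K] N.carrier) :
    signConj M L (f ∘ₗ g) = signConj N L f ∘ₗ signConj M N g :=
  LinearMap.ext fun m => by
    simp only [signConj_apply, LinearMap.comp_apply, N.sign_sign]

end SignConj

theorem homD_eq (f : M.carrier →ₗ[K] N.carrier) :
    homD M N f = N.d ∘ₗ f - signConj M N f ∘ₗ M.d := rfl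

theorem homD_signConj (f : M.carrier →ₗ[K] N.carrier) :
    homD M N (signConj M N f) = -signConj M N (homD M N f) :=
  LinearMap.ext fun m => by
    rw [homD_eq, signConj_signConj]
    simp only [LinearMap.sub_apply, LinearMap.comp_apply, LinearMap.neg_apply, signConj_apply,
      homD_apply, map_sub, N.sign_sign, N.sign_d, M.sign_d, map_neg, M.sign_sign]
    abel

theorem homD_comp_eq (f : N.carrier →ₗ[K] L.carrier) (g : M.carrier →ₗ[K] N.carrier) :
    homD M L (f ∘ₗ g) = homD N L f ∘ₗ g + signConj N L f ∘ₗ homD M N g := by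
  simp only [homD_eq, signConj_comp, LinearMap.sub_comp, LinearMap.comp_sub, LinearMap.comp_assoc]
  abel

theorem homD_id : homD M M LinearMap.id = 0 := by
  rw [homD_eq, signConj_of_mem_zero (f := LinearMap.id) (one_mem_homDeg M)]
  exact sub_self _

theorem homComplex_isAcyclic_iff : (homComplex M N).IsAcyclic ↔
    ∀ f ∈ homTotal M N, homD M N f = 0 → ∃ g ∈ homTotal M N, homD M N g = f := by
  rw [DGComplex.isAcyclic_iff]
  exact ⟨fun h f hf hd => (h ⟨f, hf⟩ (Subtype.ext hd)).elim fun g hg =>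
      ⟨g.1, g.2, congrArg Subtype.val hg⟩,
    fun h f hd => (h f.1 f.2 (congrArg Subtype.val hd)).elim fun g ⟨hg, hgf⟩ =>
      ⟨⟨g, hg⟩, Subtype.ext hgf⟩⟩

theorem exists_mem_homDeg_homD_eq (hMN : (homComplex M N).IsAcyclic) {i : ℤ}
    {f : M.carrier →ₗ[K] N.carrier} (hf : f ∈ homDeg M N (i + 1)) (hd : homD M N f = 0) :
    ∃ g ∈ homDeg M N i, homD M N g = f := by
  obtain ⟨g, hg⟩ := DGComplex.isAcyclic_iff.1 hMN ⟨f, mem_homTotal hf⟩ (Subtype.ext hd)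
  obtain ⟨g', hg', hgg'⟩ := DGComplex.exists_mem_grading_d_eq (i := i) (x := g) (by rwa [hg])
  exact ⟨g'.1, hg', congrArg Subtype.val (hgg'.trans hg)⟩

namespace Hom

variable (φ : Hom M N)

/-- The underlying `K`-linear map, an element of `Hom⁰_A(M, N)`. -/
def toKLinearMap : M.carrier →ₗ[K] N.carrier := φ.toLinearMap.restrictScalars K

theorem mem_homDeg : φ.toKLinearMap ∈ homDeg M N 0 :=
  ⟨fun j m hm => by rw [zero_add]; exact φ.map_mem j m hm, fun j a m _ => by
    rw [zero_mul, Int.negOnePow_zero, one_smul]; exact φ.toLinearMap.map_smul a m⟩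

theorem homD_eq_zero : homD M N φ.toKLinearMap = 0 := by
  rw [homD_eq, signConj_of_mem_zero φ.mem_homDeg, sub_eq_zero]
  exact LinearMap.ext fun m => (φ.map_d m).symm

variable {φ} in
theorem isQuasiIso_of_surjective (hφ : Function.Surjective φ.toLinearMap)
    (hker : ∀ m, M.d m = 0 → φ.toLinearMap m = 0 → ∃ m', φ.toLinearMap m' = 0 ∧ M.d m' = m) :
    φ.IsQuasiIso :=
  DGComplex.Hom.isQuasiIso_of_surjective (f := φ.toDGComplexHom) hφ hker

/-- A `0`-cocycle of `Hom_A(M, N)` as a homomorphism of DG modules. -/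
def ofMemHomDeg (f : M.carrier →ₗ[K] N.carrier) (hf : f ∈ homDeg M N 0) (hd : homD M N f = 0) :
    Hom M N where
  toFun := f
  map_add' := map_add f
  map_smul' a m := by
    have h : f ∘ₗ (LinearMap.toSpanSingleton A.carrier M.carrier m).restrictScalars K =
        (LinearMap.toSpanSingleton A.carrier N.carrier (f m)).restrictScalars K :=
      DGAlgebra.linearMap_ext fun j a ha => (hf.2 j a m ha).trans <| by
        rw [zero_mul, Int.negOnePow_zero, one_smul]
        rfl
    exact LinearMap.congr_fun h a
  map_mem i m hm := by
    have h := hf.1 i m hm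
    rwa [zero_add] at h
  map_d m := by
    rw [homD_eq, signConj_of_mem_zero hf, sub_eq_zero] at hd
    exact (LinearMap.congr_fun hd m).symm

end Hom

theorem mem_homTotal_of_algHom {B : DGAlgebra.{u, w'} K}
    {T : B.carrier →ₐ[K] Module.End K M.carrier}
    (hT : ∀ i, ∀ b ∈ B.grading i, T b ∈ homDeg M M i) (b : B.carrier) : T b ∈ homTotal M M := by
  have h : ⨆ i, B.grading i ≤ (homTotal M M).comap T.toLinearMap :=
    iSup_le fun i b hb => mem_homTotal (hT i b hb)
  rw [B.isInternal.submodule_iSup_eq_top] at h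
  exact h (x := b) trivial

/-- An action of a DG algebra `B` on the total space of `M` by elements of `End_A(M)`, as a
homomorphism `B → End_A(M)`. -/
def homEndAlgebra {B : DGAlgebra.{u, w'} K} (T : B.carrier →ₐ[K] Module.End K M.carrier)
    (hT : ∀ i, ∀ b ∈ B.grading i, T b ∈ homDeg M M i)
    (hd : ∀ b, T (B.d b) = homD M M (T b)) : DGAlgebra.Hom B M.endAlgebra where
  toAlgHom := T.codRestrict M.endSubalgebra (mem_homTotal_of_algHom hT)
  map_mem := hT
  map_d b := Subtype.ext (hd b)

end HomComplex

section Desusp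

/-- The desuspension `N[-1]`: the degree of each element rises by one, the differential changes
sign, and `a ∈ Aʲ` acts as `(-1)ʲ a`, so that the identity `N → N[-1]` is a cocycle of degree `1`
of `Hom_A(N, N[-1])`. -/
noncomputable def desusp (N : DGModule.{u, v, w} A) : DGModule.{u, v, w} A where
  carrier := N.carrier
  grading i := N.grading (i - 1)
  isInternal := by
    have h := (DirectSum.isInternal_submodule_iff_iSupIndep_and_iSup_eq_top _).1 N.isInternal
    exact (DirectSum.isInternal_submodule_iff_iSupIndep_and_iSup_eq_top _).2
      ⟨h.1.comp (sub_left_injective (b := 1)),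
        ((Equiv.subRight 1).iSup_comp (g := N.grading)).trans h.2⟩
  d := -N.d
  d_mem i x hx := by
    have h := neg_mem (N.d_mem (i - 1) x hx)
    rwa [sub_add_eq_add_sub] at h
  d_d x := by rw [LinearMap.neg_apply, LinearMap.neg_apply, map_neg, neg_neg, N.d_d]
  moduleA := Module.compHom N.carrier A.signHom.toRingHom
  isScalarTower := by
    refine @IsScalarTower.mk _ _ _ _ (_) _ fun k a n => ?_
    change A.signHom (k • a) • n = k • (A.signHom a • n)
    rw [map_smul, smul_assoc]
  smul_mem i j a n ha hn := by
    change A.signHom a • n ∈ N.grading (i + j - 1)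
    rw [DGAlgebra.signHom_of_mem ha, smul_assoc, add_sub_assoc]
    exact negOnePow_smul_mem i (N.smul_mem i (j - 1) a n ha hn)
  d_smul i a n ha := by
    change -N.d (A.signHom a • n) = A.signHom (A.d a) • n + i.negOnePow • (A.signHom a • -N.d n)
    rw [DGAlgebra.signHom_of_mem ha, DGAlgebra.signHom_of_mem (A.d_mem i a ha), smul_assoc,
      smul_assoc, smul_assoc, map_negOnePow_smul, N.d_smul i a n ha, Int.negOnePow_succ,
      Units.neg_smul, smul_neg, smul_neg, smul_add, neg_add, smul_neg]

/-- The identity `N → N[-1]`, of degree `1`. -/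
noncomputable def toDesusp (N : DGModule.{u, v, w} A) : N.carrier →ₗ[K] N.desusp.carrier :=
  LinearMap.id

/-- The identity `N[-1] → N`, of degree `-1`. -/
noncomputable def ofDesusp (N : DGModule.{u, v, w} A) : N.desusp.carrier →ₗ[K] N.carrier :=
  LinearMap.id

variable (N : DGModule.{u, v, w} A)

theorem ofDesusp_comp_toDesusp : N.ofDesusp ∘ₗ N.toDesusp = LinearMap.id := rfl

theorem toDesusp_comp_ofDesusp : N.toDesusp ∘ₗ N.ofDesusp = LinearMap.id := rfl

theorem toDesusp_mem_homDeg : N.toDesusp ∈ homDeg N N.desusp 1 := by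
  refine ⟨fun j m hm => ?_, fun j a m ha => ?_⟩
  · change m ∈ N.grading (1 + j - 1)
    rwa [add_sub_cancel_left]
  · change a • m = (1 * j).negOnePow • (A.signHom a • m)
    rw [DGAlgebra.signHom_of_mem ha, one_mul, smul_assoc, negOnePow_smul_smul_self]

theorem ofDesusp_mem_homDeg : N.ofDesusp ∈ homDeg N.desusp N (-1) := by
  refine ⟨fun j m hm => ?_, fun j a (m : N.carrier) ha => ?_⟩
  · change m ∈ N.grading (-1 + j)
    rwa [neg_add_eq_sub]
  · change A.signHom a • m = (-1 * j).negOnePow • (a • m)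
    rw [DGAlgebra.signHom_of_mem ha, neg_one_mul, Int.negOnePow_neg, smul_assoc]

theorem homD_toDesusp : homD N N.desusp N.toDesusp = 0 := by
  rw [homD_eq, signConj_of_mem_one N.toDesusp_mem_homDeg]
  exact LinearMap.ext fun m => sub_self (-N.d m)

theorem signConj_ofDesusp : signConj N.desusp N N.ofDesusp = -N.ofDesusp := by
  rw [signConj_of_mem N.ofDesusp_mem_homDeg, Int.negOnePow_neg, Int.negOnePow_one,
    Units.neg_smul, one_smul]

theorem homD_ofDesusp : homD N.desusp N N.ofDesusp = 0 := by
  rw [homD_eq, signConj_ofDesusp]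
  exact LinearMap.ext fun m => by
    change N.d m - -(-N.d m) = 0
    rw [neg_neg, sub_self]

end Desusp

/-- A cocycle of degree `1` of `Hom_A(Y, X)`, which classifies an extension of `Y` by `X` that
splits after forgetting the differentials. -/
structure ExtClass (Y X : DGModule.{u, v, w} A) where
  toLinearMap : Y.carrier →ₗ[K] X.carrier
  mem_homDeg : toLinearMap ∈ homDeg Y X 1
  homD_eq_zero : homD Y X toLinearMap = 0

namespace ExtClass

variable {X Y : DGModule.{u, v, w} A} (σ : ExtClass Y X)

theorem d_apply (y : Y.carrier) : X.d (σ.toLinearMap y) = -σ.toLinearMap (Y.d y) := by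
  have h := LinearMap.congr_fun σ.homD_eq_zero y
  rwa [homD_eq, signConj_of_mem_one σ.mem_homDeg, LinearMap.neg_comp, sub_neg_eq_add,
    LinearMap.add_apply, LinearMap.zero_apply, add_eq_zero_iff_eq_neg] at h

/-- The extension of `Y` by `X` with class `σ`: the sum `X ⊕ Y` with `d (x, y) = (dx + σ y, dy)`. -/
noncomputable def extension : DGModule.{u, v, w} A where
  carrier := X.carrier × Y.carrier
  grading i := (X.grading i).prod (Y.grading i)
  isInternal := isInternal_prod X.isInternal Y.isInternal
  d := (X.d.coprod σ.toLinearMap).prod (Y.d ∘ₗ LinearMap.snd K X.carrier Y.carrier)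
  d_mem i e he := by
    have h := σ.mem_homDeg.1 i e.2 he.2
    rw [add_comm] at h
    exact ⟨add_mem (X.d_mem i e.1 he.1) h, Y.d_mem i e.2 he.2⟩
  d_d e := Prod.ext
    (by
      change X.d (X.d e.1 + σ.toLinearMap e.2) + σ.toLinearMap (Y.d e.2) = 0
      rw [map_add, X.d_d, σ.d_apply, zero_add, neg_add_cancel])
    (Y.d_d e.2)
  smul_mem i j a e ha he := ⟨X.smul_mem i j a e.1 ha he.1, Y.smul_mem i j a e.2 ha he.2⟩
  d_smul i a e ha := Prod.ext
    (by
      change X.d (a • e.1) + σ.toLinearMap (a • e.2) =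
        A.d a • e.1 + i.negOnePow • (a • (X.d e.1 + σ.toLinearMap e.2))
      rw [X.d_smul i a e.1 ha, σ.mem_homDeg.2 i a e.2 ha, one_mul, smul_add, smul_add, add_assoc])
    (Y.d_smul i a e.2 ha)

/-- The inclusion `X → X ⊕ Y` of `σ.extension`. -/
noncomputable def inl : X.carrier →ₗ[K] σ.extension.carrier := LinearMap.inl K X.carrier Y.carrier

/-- The section `Y → X ⊕ Y` of `σ.extension`, which does not commute with the differentials. -/
noncomputable def inr : Y.carrier →ₗ[K] σ.extension.carrier := LinearMap.inr K X.carrier Y.carrier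

/-- The retraction `X ⊕ Y → X` of `σ.extension`, which does not commute with the differentials. -/
noncomputable def fst : σ.extension.carrier →ₗ[K] X.carrier := LinearMap.fst K X.carrier Y.carrier

/-- The projection `X ⊕ Y → Y` of `σ.extension`. -/
noncomputable def snd : σ.extension.carrier →ₗ[K] Y.carrier := LinearMap.snd K X.carrier Y.carrier

theorem fst_comp_inl : σ.fst ∘ₗ σ.inl = LinearMap.id := rfl

theorem snd_comp_inl : σ.snd ∘ₗ σ.inl = 0 := rfl

theorem snd_comp_inr : σ.snd ∘ₗ σ.inr = LinearMap.id := rfl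

theorem inl_comp_fst_add_inr_comp_snd :
    σ.inl ∘ₗ σ.fst + σ.inr ∘ₗ σ.snd = LinearMap.id :=
  LinearMap.ext fun e => Prod.ext (add_zero e.1) (zero_add e.2)

theorem inl_mem_homDeg : σ.inl ∈ homDeg X σ.extension 0 :=
  ⟨fun j x hx => ⟨by rwa [zero_add], zero_mem _⟩, fun j a x _ => by
    rw [zero_mul, Int.negOnePow_zero, one_smul]
    exact Prod.ext rfl (smul_zero a).symm⟩

theorem inr_mem_homDeg : σ.inr ∈ homDeg Y σ.extension 0 :=
  ⟨fun j y hy => ⟨zero_mem _, by rwa [zero_add]⟩, fun j a y _ => by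
    rw [zero_mul, Int.negOnePow_zero, one_smul]
    exact Prod.ext (smul_zero a).symm rfl⟩

theorem fst_mem_homDeg : σ.fst ∈ homDeg σ.extension X 0 :=
  ⟨fun j e he => by rw [zero_add]; exact he.1, fun j a e _ => by
    rw [zero_mul, Int.negOnePow_zero, one_smul]
    rfl⟩

theorem snd_mem_homDeg : σ.snd ∈ homDeg σ.extension Y 0 :=
  ⟨fun j e he => by rw [zero_add]; exact he.2, fun j a e _ => by
    rw [zero_mul, Int.negOnePow_zero, one_smul]
    rfl⟩

theorem d_inl (x : X.carrier) : σ.extension.d (σ.inl x) = σ.inl (X.d x) :=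
  Prod.ext ((congrArg _ (map_zero σ.toLinearMap)).trans (add_zero _)) (map_zero Y.d)

theorem homD_inl : homD X σ.extension σ.inl = 0 := by
  rw [homD_eq, signConj_of_mem_zero σ.inl_mem_homDeg, sub_eq_zero]
  exact LinearMap.ext σ.d_inl

theorem homD_inr : homD Y σ.extension σ.inr = σ.inl ∘ₗ σ.toLinearMap := by
  rw [homD_eq, signConj_of_mem_zero σ.inr_mem_homDeg, sub_eq_iff_eq_add]
  exact LinearMap.ext fun y => Prod.ext
    ((congrArg (· + _) (map_zero X.d)).trans (add_comm _ _)) (zero_add _).symm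

theorem homD_fst : homD σ.extension X σ.fst = -(σ.toLinearMap ∘ₗ σ.snd) := by
  rw [homD_eq, signConj_of_mem_zero σ.fst_mem_homDeg]
  exact LinearMap.ext fun e => sub_add_cancel_left (X.d e.1) (σ.toLinearMap e.2)

theorem homD_snd : homD σ.extension Y σ.snd = 0 := by
  rw [homD_eq, signConj_of_mem_zero σ.snd_mem_homDeg, sub_eq_zero]
  rfl

theorem signConj_comp_inl_eq_zero {N : DGModule.{u, v, w'} A}
    {f : σ.extension.carrier →ₗ[K] N.carrier}
    (hf : f ∘ₗ σ.inl = 0) : signConj σ.extension N f ∘ₗ σ.inl = 0 := by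
  rw [← signConj_of_mem_zero σ.inl_mem_homDeg, ← signConj_comp, hf, map_zero]

theorem exists_homD_comp_snd_eq {N : DGModule.{u, v, w'} A} (hYN : (homComplex Y N).IsAcyclic)
    {f : σ.extension.carrier →ₗ[K] N.carrier} (hf : f ∈ homTotal σ.extension N)
    (hd : homD σ.extension N f = 0) (hinl : f ∘ₗ σ.inl = 0) :
    ∃ k ∈ homTotal Y N, homD σ.extension N (k ∘ₗ σ.snd) = f := by
  obtain ⟨k, hk, hkf⟩ := homComplex_isAcyclic_iff.1 hYN (f ∘ₗ σ.inr)
    (comp_mem_homTotal hf (mem_homTotal σ.inr_mem_homDeg))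
    (by rw [homD_comp_eq, hd, σ.homD_inr, LinearMap.zero_comp, ← LinearMap.comp_assoc,
      σ.signConj_comp_inl_eq_zero hinl, LinearMap.zero_comp, add_zero])
  refine ⟨k, hk, ?_⟩
  calc homD σ.extension N (k ∘ₗ σ.snd)
      = f ∘ₗ (σ.inl ∘ₗ σ.fst + σ.inr ∘ₗ σ.snd) := by
        rw [homD_comp_eq, hkf, σ.homD_snd, LinearMap.comp_zero, add_zero, LinearMap.comp_add,
          ← LinearMap.comp_assoc σ.fst, hinl, LinearMap.zero_comp, zero_add,
          LinearMap.comp_assoc]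
    _ = f := by rw [σ.inl_comp_fst_add_inr_comp_snd, LinearMap.comp_id]

theorem exists_homD_inl_comp_eq {N : DGModule.{u, v, w'} A} (hNX : (homComplex N X).IsAcyclic)
    {f : N.carrier →ₗ[K] σ.extension.carrier} (hf : f ∈ homTotal N σ.extension)
    (hd : homD N σ.extension f = 0) (hsnd : σ.snd ∘ₗ f = 0) :
    ∃ k ∈ homTotal N X, homD N σ.extension (σ.inl ∘ₗ k) = f := by
  obtain ⟨k, hk, hkf⟩ := homComplex_isAcyclic_iff.1 hNX (σ.fst ∘ₗ f)
    (comp_mem_homTotal (mem_homTotal σ.fst_mem_homDeg) hf)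
    (by rw [homD_comp_eq, hd, σ.homD_fst, LinearMap.comp_zero, LinearMap.neg_comp,
      LinearMap.comp_assoc, hsnd, LinearMap.comp_zero, neg_zero, add_zero])
  refine ⟨k, hk, ?_⟩
  calc homD N σ.extension (σ.inl ∘ₗ k)
      = (σ.inl ∘ₗ σ.fst + σ.inr ∘ₗ σ.snd) ∘ₗ f := by
        rw [homD_comp_eq, hkf, σ.homD_inl, LinearMap.zero_comp, zero_add,
          signConj_of_mem_zero σ.inl_mem_homDeg, LinearMap.add_comp, LinearMap.comp_assoc f σ.snd,
          hsnd, LinearMap.comp_zero, add_zero, LinearMap.comp_assoc]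
    _ = f := by rw [σ.inl_comp_fst_add_inr_comp_snd, LinearMap.id_comp]

/-- The projection of an extension onto its quotient. -/
noncomputable def proj : Hom σ.extension Y := Hom.ofMemHomDeg σ.snd σ.snd_mem_homDeg σ.homD_snd

theorem proj_isQuasiIso (hX : X.toDGComplex.IsAcyclic) : σ.proj.IsQuasiIso := by
  refine Hom.isQuasiIso_of_surjective (fun y => ⟨σ.inr y, rfl⟩) ?_
  rintro ⟨x, y⟩ hd (rfl : y = 0)
  have hx : X.d x + σ.toLinearMap 0 = 0 := congrArg Prod.fst hd
  rw [map_zero, add_zero] at hx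
  obtain ⟨x', rfl⟩ := DGComplex.isAcyclic_iff.1 hX x hx
  exact ⟨σ.inl x', rfl, σ.d_inl x'⟩

end ExtClass

namespace IsKProjective

variable {X Y P : DGModule.{u, v, w} A}

theorem desusp (hP : P.IsKProjective) : P.desusp.IsKProjective := by
  intro N hN
  rw [homComplex_isAcyclic_iff]
  intro f hf hd
  obtain ⟨g, hg, hgf⟩ := homComplex_isAcyclic_iff.1 (hP N hN) (f ∘ₗ P.toDesusp)
    (comp_mem_homTotal hf (mem_homTotal P.toDesusp_mem_homDeg))
    (by rw [homD_comp_eq, hd, homD_toDesusp, LinearMap.zero_comp, LinearMap.comp_zero, add_zero])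
  refine ⟨g ∘ₗ P.ofDesusp, comp_mem_homTotal hg (mem_homTotal P.ofDesusp_mem_homDeg), ?_⟩
  rw [homD_comp_eq, hgf, homD_ofDesusp, LinearMap.comp_zero, add_zero, LinearMap.comp_assoc,
    toDesusp_comp_ofDesusp, LinearMap.comp_id]

theorem extension (hX : X.IsKProjective) (hY : Y.IsKProjective) (σ : ExtClass Y X) :
    σ.extension.IsKProjective := by
  intro N hN
  rw [homComplex_isAcyclic_iff]
  intro f hf hd
  obtain ⟨g, hg, hgf⟩ := homComplex_isAcyclic_iff.1 (hX N hN) (f ∘ₗ σ.inl)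
    (comp_mem_homTotal hf (mem_homTotal σ.inl_mem_homDeg))
    (by rw [homD_comp_eq, hd, σ.homD_inl, LinearMap.zero_comp, LinearMap.comp_zero, add_zero])
  have hg' : g ∘ₗ σ.fst ∈ homTotal σ.extension N :=
    comp_mem_homTotal hg (mem_homTotal σ.fst_mem_homDeg)
  have hcomp_inl : homD σ.extension N (g ∘ₗ σ.fst) ∘ₗ σ.inl = f ∘ₗ σ.inl := by
    have h := homD_comp_eq (g ∘ₗ σ.fst) σ.inl
    rwa [σ.homD_inl, LinearMap.comp_zero, add_zero, LinearMap.comp_assoc, σ.fst_comp_inl,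
      LinearMap.comp_id, hgf, eq_comm] at h
  obtain ⟨k, hk, hkf⟩ := σ.exists_homD_comp_snd_eq (hY N hN)
    (sub_mem hf (homD_mem_homTotal _ _ _ hg'))
    (by rw [map_sub, hd, homD_homD _ _ _ hg', sub_zero])
    (by rw [LinearMap.sub_comp, hcomp_inl, sub_self])
  exact ⟨g ∘ₗ σ.fst + k ∘ₗ σ.snd,
    add_mem hg' (comp_mem_homTotal hk (mem_homTotal σ.snd_mem_homDeg)), by
      rw [map_add, hkf, add_sub_cancel]⟩

theorem homComplex_isAcyclic_of_isAcyclic (hP : P.IsKProjective) (hP₀ : P.toDGComplex.IsAcyclic)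
    (N : DGModule.{u, v, w'} A) : (homComplex P N).IsAcyclic := by
  obtain ⟨h, hh, hd⟩ := homComplex_isAcyclic_iff.1 (hP P hP₀) LinearMap.id
    (mem_homTotal (one_mem_homDeg P)) homD_id
  refine homComplex_isAcyclic_iff.2 fun f hf hfd =>
    ⟨signConj P N f ∘ₗ h, comp_mem_homTotal (signConj_mem_homTotal hf) hh, ?_⟩
  rw [homD_comp_eq, homD_signConj, hfd, map_zero, neg_zero, LinearMap.zero_comp, zero_add,
    signConj_signConj, hd, LinearMap.comp_id]

end IsKProjective

section Cocone

variable {M N P P' : DGModule.{u, v, w} A}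

/-- The class of the cocone of `φ : M → N`, an extension of `M` by `N[-1]`. -/
noncomputable def Hom.coconeClass (φ : Hom M N) : ExtClass M N.desusp where
  toLinearMap := N.toDesusp ∘ₗ φ.toKLinearMap
  mem_homDeg := by
    have h := comp_mem_homDeg N.toDesusp_mem_homDeg φ.mem_homDeg
    rwa [add_zero] at h
  homD_eq_zero := by
    rw [homD_comp_eq, homD_toDesusp, φ.homD_eq_zero, LinearMap.zero_comp, LinearMap.comp_zero,
      add_zero]

/-- The cocone of `φ : M → N`: the sum `N[-1] ⊕ M` with `d (y, x) = (-dy + φ x, dx)`. -/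
noncomputable abbrev Hom.cocone (φ : Hom M N) : DGModule.{u, v, w} A := φ.coconeClass.extension

theorem Hom.d_cocone (φ : Hom M N) (y : N.carrier) (x : M.carrier) :
    φ.cocone.d ((y, x) : N.carrier × M.carrier) =
      ((-N.d y + φ.toLinearMap x, M.d x) : N.carrier × M.carrier) := rfl

theorem Hom.IsQuasiIso.cocone_isAcyclic {φ : Hom M N} (hφ : φ.IsQuasiIso) :
    φ.cocone.toDGComplex.IsAcyclic := by
  obtain ⟨hinj, hsurj⟩ := (DGComplex.Hom.isQuasiIso_iff φ.toDGComplexHom).1 hφ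
  have exact_of_cocycle (y : N.carrier) (x : M.carrier) (hy : φ.toLinearMap x = N.d y)
      (hx : M.d x = 0) :
      ∃ (z : N.carrier) (x' : M.carrier), -N.d z + φ.toLinearMap x' = y ∧ M.d x' = x := by
    obtain ⟨x₁, rfl⟩ := hinj x hx y hy
    obtain ⟨x₂, hx₂, z, hz⟩ := hsurj (y - φ.toLinearMap x₁)
      ((map_sub N.d _ _).trans (by rw [← φ.map_d, hy, sub_self]))
    replace hz : φ.toLinearMap x₂ - (y - φ.toLinearMap x₁) = N.d z := hz
    refine ⟨z, x₁ + x₂, ?_, ?_⟩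
    · rw [← hz, map_add]
      abel
    · exact (map_add M.d x₁ x₂).trans ((congrArg _ hx₂).trans (add_zero _))
  refine DGComplex.isAcyclic_iff.2 fun ⟨y, x⟩ hd => ?_
  obtain ⟨hy, hx⟩ := Prod.ext_iff.1 ((φ.d_cocone y x).symm.trans hd)
  obtain ⟨z, x', hz, hx'⟩ := exact_of_cocycle y x (neg_add_eq_zero.1 hy).symm hx
  exact ⟨_, (φ.d_cocone z x').trans (Prod.ext hz hx')⟩

theorem IsKProjective.exists_lift (hP : P.IsKProjective) {q : Hom N M} (hq : q.IsQuasiIso)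
    (p : Hom P M) : ∃ (f : Hom P N) (h : P.carrier →ₗ[K] M.carrier),
      homD P M h = q.toKLinearMap ∘ₗ f.toKLinearMap - p.toKLinearMap := by
  let γ := q.coconeClass
  have hc : γ.inl ∘ₗ M.toDesusp ∘ₗ p.toKLinearMap ∈ homDeg P γ.extension (0 + 1) := by
    have h := comp_mem_homDeg γ.inl_mem_homDeg
      (comp_mem_homDeg M.toDesusp_mem_homDeg p.mem_homDeg)
    rwa [add_zero] at h
  obtain ⟨g, hg, hgc⟩ := exists_mem_homDeg_homD_eq (hP γ.extension hq.cocone_isAcyclic) hc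
    (by simp only [homD_comp_eq, γ.homD_inl, homD_toDesusp, p.homD_eq_zero,
      LinearMap.zero_comp, LinearMap.comp_zero, add_zero])
  have hf : γ.snd ∘ₗ g ∈ homDeg P N 0 := comp_mem_homDeg γ.snd_mem_homDeg hg
  have hf_closed : homD P N (γ.snd ∘ₗ g) = 0 := by
    rw [homD_comp_eq, γ.homD_snd, hgc, signConj_of_mem_zero γ.snd_mem_homDeg,
      ← LinearMap.comp_assoc, γ.snd_comp_inl, LinearMap.zero_comp, LinearMap.zero_comp, add_zero]
  have hfst : homD P M.desusp (γ.fst ∘ₗ g) =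
      M.toDesusp ∘ₗ (p.toKLinearMap - q.toKLinearMap ∘ₗ γ.snd ∘ₗ g) := by
    rw [homD_comp_eq, γ.homD_fst, hgc, signConj_of_mem_zero γ.fst_mem_homDeg,
      ← LinearMap.comp_assoc, γ.fst_comp_inl, LinearMap.id_comp, LinearMap.comp_sub, sub_eq_neg_add]
    rfl
  refine ⟨Hom.ofMemHomDeg _ hf hf_closed, M.ofDesusp ∘ₗ γ.fst ∘ₗ g, ?_⟩
  rw [homD_comp_eq, hfst, homD_ofDesusp, signConj_ofDesusp, LinearMap.zero_comp, zero_add,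
    LinearMap.neg_comp, ← LinearMap.comp_assoc, ofDesusp_comp_toDesusp, LinearMap.id_comp, neg_sub]
  rfl

theorem exists_isQuasiIso_of_isKProjective (hP : P.IsKProjective) {p : Hom P M} {p' : Hom P' M}
    (hp : p.IsQuasiIso) (hp' : p'.IsQuasiIso) : ∃ φ : Hom P P', φ.IsQuasiIso := by
  obtain ⟨φ, h, hφ⟩ := hP.exists_lift hp' p
  refine ⟨φ, ?_⟩
  have hcomp : p'.toDGComplexHom.cohomologyMap ∘ₗ φ.toDGComplexHom.cohomologyMap =
      p.toDGComplexHom.cohomologyMap := by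
    rw [← DGComplex.Hom.cohomologyMap_comp]
    refine DGComplex.Hom.cohomologyMap_eq_of_sub_mem_range_d fun x hx => ⟨h x, ?_⟩
    have hx' := LinearMap.congr_fun hφ x
    rw [homD_eq, LinearMap.sub_apply, LinearMap.comp_apply, LinearMap.comp_apply, hx, map_zero,
      sub_zero] at hx'
    exact hx'
  refine (Function.Bijective.of_comp_iff' hp' _).1 ?_
  rw [← LinearMap.coe_comp, hcomp]
  exact hp

end Cocone

section EndAlgebra

variable (M : DGModule.{u, v, w} A)

/-- The inclusion of `End_A(M)` into the algebra of all `K`-linear endomorphisms. -/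
def endVal : M.endAlgebra.carrier →ₐ[K] Module.End K M.carrier := M.endSubalgebra.val

variable {M}

theorem endVal_injective : Function.Injective M.endVal := Subtype.val_injective

theorem endVal_mem_homTotal (a : M.endAlgebra.carrier) : M.endVal a ∈ homTotal M M := a.2

theorem exists_endVal_eq {f : Module.End K M.carrier} (hf : f ∈ homTotal M M) :
    ∃ a, M.endVal a = f := ⟨⟨f, hf⟩, rfl⟩

theorem endVal_mem_homDeg {i : ℤ} {a : M.endAlgebra.carrier} (ha : a ∈ M.endAlgebra.grading i) :
    M.endVal a ∈ homDeg M M i := ha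

theorem endVal_d (a : M.endAlgebra.carrier) :
    M.endVal (M.endAlgebra.d a) = homD M M (M.endVal a) := rfl

end EndAlgebra

theorem homEndAlgebra_isQuasiIso {M : DGModule.{u, v, w} A} {B : DGAlgebra.{u, w'} K}
    {T : B.carrier →ₐ[K] Module.End K M.carrier}
    {hT : ∀ i, ∀ b ∈ B.grading i, T b ∈ homDeg M M i}
    {hd : ∀ b, T (B.d b) = homD M M (T b)}
    (hsurj : ∀ f ∈ homTotal M M, ∃ b, T b = f)
    (hker : ∀ b, B.d b = 0 → T b = 0 → ∃ c, T c = 0 ∧ B.d c = b) :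
    (homEndAlgebra T hT hd).IsQuasiIso := by
  refine DGComplex.Hom.isQuasiIso_of_surjective (fun f => ?_) fun b hb hTb => ?_
  · obtain ⟨b, hbf⟩ := hsurj f.1 f.2
    exact ⟨b, Subtype.ext hbf⟩
  · obtain ⟨c, hTc, hcb⟩ := hker b hb (congrArg Subtype.val hTb)
    exact ⟨c, Subtype.ext hTc, hcb⟩

section DesuspEnd

variable (N : DGModule.{u, v, w} A)

/-- Conjugation by the identity `N → N[-1]` of degree `1`, up to the sign `(-1)ⁱ` on elements of
degree `i` which makes it commute with the differentials. -/
noncomputable def desuspConj : N.desusp.endAlgebra.carrier →ₐ[K] Module.End K N.carrier :=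
  AlgHom.ofLinearMap
    (LinearMap.llcomp K _ _ _ N.ofDesusp ∘ₗ LinearMap.lcomp K _ N.toDesusp ∘ₗ
      signConj N.desusp N.desusp ∘ₗ N.desusp.endVal.toLinearMap)
    (congrArg (fun f => N.ofDesusp ∘ₗ f ∘ₗ N.toDesusp)
      (signConj_of_mem_zero (one_mem_homDeg N.desusp)))
    fun _ _ => congrArg (fun f => N.ofDesusp ∘ₗ f ∘ₗ N.toDesusp)
      (signConj_comp _ _)

theorem desuspConj_apply (a : N.desusp.endAlgebra.carrier) :
    N.desuspConj a = N.ofDesusp ∘ₗ signConj N.desusp N.desusp (N.desusp.endVal a) ∘ₗ N.toDesusp :=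
  rfl

theorem desuspConj_injective : Function.Injective N.desuspConj := fun _ _ hab =>
  endVal_injective (Function.LeftInverse.injective signConj_signConj hab)

theorem exists_desuspConj_eq {f : Module.End K N.carrier} (hf : f ∈ homTotal N N) :
    ∃ a, N.desuspConj a = f := by
  obtain ⟨a, ha⟩ := exists_endVal_eq (signConj_mem_homTotal
    (comp_mem_homTotal (mem_homTotal N.toDesusp_mem_homDeg)
      (comp_mem_homTotal hf (mem_homTotal N.ofDesusp_mem_homDeg))))
  exact ⟨a, by rw [desuspConj_apply, ha, signConj_signConj]; rfl⟩

theorem desuspConj_mem_homDeg {i : ℤ} {a : N.desusp.endAlgebra.carrier}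
    (ha : a ∈ N.desusp.endAlgebra.grading i) : N.desuspConj a ∈ homDeg N N i := by
  have h := comp_mem_homDeg N.ofDesusp_mem_homDeg
    (comp_mem_homDeg (signConj_mem_homDeg (endVal_mem_homDeg ha)) N.toDesusp_mem_homDeg)
  rwa [neg_add_cancel_comm_assoc] at h

theorem desuspConj_d (a : N.desusp.endAlgebra.carrier) :
    N.desuspConj (N.desusp.endAlgebra.d a) = homD N N (N.desuspConj a) := by
  rw [desuspConj_apply, desuspConj_apply, endVal_d, homD_comp_eq, homD_comp_eq, homD_ofDesusp,
    homD_toDesusp, homD_signConj, signConj_ofDesusp, LinearMap.zero_comp, zero_add,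
    LinearMap.comp_zero, add_zero, LinearMap.neg_comp, LinearMap.neg_comp, LinearMap.comp_neg,
    neg_neg]

/-- The isomorphism `End_A(N[-1]) → End_A(N)` of DG algebras. -/
noncomputable def desuspEnd : DGAlgebra.Hom N.desusp.endAlgebra N.endAlgebra :=
  homEndAlgebra N.desuspConj (fun _ _ ha => N.desuspConj_mem_homDeg ha) N.desuspConj_d

theorem desuspEnd_isQuasiIso : N.desuspEnd.IsQuasiIso :=
  homEndAlgebra_isQuasiIso (fun _ hf => N.exists_desuspConj_eq hf) fun a _ ha =>
    ⟨0, map_zero _, by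
      rw [map_zero, N.desuspConj_injective (ha.trans (map_zero _).symm)]⟩

end DesuspEnd

namespace ExtClass

variable {X Y : DGModule.{u, v, w} A} (σ : ExtClass Y X)

/-- The map `End_A(X ⊕ Y) → Hom_A(X, Y)` taking an endomorphism of `σ.extension` to its
off-diagonal entry. -/
noncomputable def offDiag :
    DGComplex.Hom σ.extension.endAlgebra.toDGComplex (homComplex X Y) where
  toLinearMap := LinearMap.restrict (p := homTotal σ.extension σ.extension) (q := homTotal X Y)
    (LinearMap.llcomp K _ _ _ σ.snd ∘ₗ LinearMap.lcomp K _ σ.inl)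
    fun a ha => comp_mem_homTotal (mem_homTotal σ.snd_mem_homDeg)
      (comp_mem_homTotal ha (mem_homTotal σ.inl_mem_homDeg))
  map_mem i a ha := by
    have h := comp_mem_homDeg σ.snd_mem_homDeg
      (comp_mem_homDeg (endVal_mem_homDeg ha) σ.inl_mem_homDeg)
    rwa [add_zero, zero_add] at h
  map_d a := Subtype.ext <| by
    change σ.snd ∘ₗ homD _ _ (σ.extension.endVal a) ∘ₗ σ.inl =
      homD _ _ (σ.snd ∘ₗ σ.extension.endVal a ∘ₗ σ.inl)
    rw [homD_comp_eq, homD_comp_eq, homD_snd, homD_inl, signConj_of_mem_zero σ.snd_mem_homDeg,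
      LinearMap.zero_comp, LinearMap.comp_zero, add_zero, zero_add]

theorem offDiag_eq_zero_iff {a : σ.extension.endAlgebra.carrier} :
    σ.offDiag.toLinearMap a = 0 ↔ σ.snd ∘ₗ σ.extension.endVal a ∘ₗ σ.inl = 0 :=
  Subtype.ext_iff

theorem snd_comp_eq {f : Module.End K σ.extension.carrier} (hf : σ.snd ∘ₗ f ∘ₗ σ.inl = 0) :
    σ.snd ∘ₗ f = (σ.snd ∘ₗ f ∘ₗ σ.inr) ∘ₗ σ.snd :=
  calc σ.snd ∘ₗ f
      = (σ.snd ∘ₗ f) ∘ₗ (σ.inl ∘ₗ σ.fst + σ.inr ∘ₗ σ.snd) := by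
        rw [σ.inl_comp_fst_add_inr_comp_snd, LinearMap.comp_id]
    _ = (σ.snd ∘ₗ f ∘ₗ σ.inl) ∘ₗ σ.fst + (σ.snd ∘ₗ f ∘ₗ σ.inr) ∘ₗ σ.snd := LinearMap.comp_add ..
    _ = (σ.snd ∘ₗ f ∘ₗ σ.inr) ∘ₗ σ.snd := by rw [hf, LinearMap.zero_comp, zero_add]

theorem comp_inl_eq {f : Module.End K σ.extension.carrier} (hf : σ.snd ∘ₗ f ∘ₗ σ.inl = 0) :
    f ∘ₗ σ.inl = σ.inl ∘ₗ σ.fst ∘ₗ f ∘ₗ σ.inl :=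
  calc f ∘ₗ σ.inl
      = (σ.inl ∘ₗ σ.fst + σ.inr ∘ₗ σ.snd) ∘ₗ f ∘ₗ σ.inl := by
        rw [σ.inl_comp_fst_add_inr_comp_snd, LinearMap.id_comp]
    _ = σ.inl ∘ₗ σ.fst ∘ₗ f ∘ₗ σ.inl + σ.inr ∘ₗ σ.snd ∘ₗ f ∘ₗ σ.inl := LinearMap.add_comp ..
    _ = σ.inl ∘ₗ σ.fst ∘ₗ f ∘ₗ σ.inl := by rw [hf, LinearMap.comp_zero, add_zero]

/-- The endomorphisms of `σ.extension` preserving `X`, as a subalgebra. -/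
noncomputable def stabilizer : Subalgebra K σ.extension.endAlgebra.carrier :=
  Submodule.toSubalgebra (A := σ.extension.endAlgebra.carrier)
    (LinearMap.ker σ.offDiag.toLinearMap)
    (σ.offDiag_eq_zero_iff.2 σ.snd_comp_inl)
    fun a b ha hb => σ.offDiag_eq_zero_iff.2 <| by
      rw [map_mul, Module.End.mul_eq_comp, LinearMap.comp_assoc,
        σ.comp_inl_eq (σ.offDiag_eq_zero_iff.1 hb)]
      exact congrArg (· ∘ₗ (σ.fst ∘ₗ σ.extension.endVal b ∘ₗ σ.inl)) (σ.offDiag_eq_zero_iff.1 ha)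

/-- The DG algebra of endomorphisms of `σ.extension` preserving `X`. -/
noncomputable def triangularEnd : DGAlgebra.{u, w} K :=
  σ.extension.endAlgebra.ofSubalgebra σ.stabilizer
    (fun a ha i => by
      have h := DGComplex.map_component σ.offDiag.toLinearMap 0
        (fun j b hb => by rw [add_zero]; exact σ.offDiag.map_mem j b hb) i a
      exact h.trans ((congrArg _ ha).trans (map_zero _)))
    fun a ha => (σ.offDiag.map_d a).trans ((congrArg _ ha).trans (map_zero _))

/-- The inclusion of the endomorphisms preserving `X`. -/
noncomputable def triangularEndVal : DGAlgebra.Hom σ.triangularEnd σ.extension.endAlgebra :=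
  DGAlgebra.ofSubalgebraVal ..

/-- The action of `σ.triangularEnd` on the total space of `σ.extension`. -/
noncomputable def act : σ.triangularEnd.carrier →ₐ[K] Module.End K σ.extension.carrier :=
  σ.extension.endVal.comp σ.triangularEndVal.toAlgHom

theorem act_injective : Function.Injective σ.act :=
  endVal_injective.comp Subtype.val_injective

theorem act_d (b : σ.triangularEnd.carrier) :
    σ.act (σ.triangularEnd.d b) = homD _ _ (σ.act b) := rfl

theorem act_mem_homDeg {i : ℤ} {b : σ.triangularEnd.carrier} (hb : b ∈ σ.triangularEnd.grading i) :
    σ.act b ∈ homDeg σ.extension σ.extension i := hb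

theorem act_mem_homTotal (b : σ.triangularEnd.carrier) :
    σ.act b ∈ homTotal σ.extension σ.extension := endVal_mem_homTotal _

variable {σ} in
theorem snd_comp_act_comp_inl (b : σ.triangularEnd.carrier) : σ.snd ∘ₗ σ.act b ∘ₗ σ.inl = 0 :=
  σ.offDiag_eq_zero_iff.1 b.2

theorem exists_act_eq {f : Module.End K σ.extension.carrier}
    (hf : f ∈ homTotal σ.extension σ.extension) (hinl : σ.snd ∘ₗ f ∘ₗ σ.inl = 0) :
    ∃ b, σ.act b = f :=
  ⟨⟨⟨f, hf⟩, σ.offDiag_eq_zero_iff.2 hinl⟩, rfl⟩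

/-- The diagonal entry in `End_K(Y)` of an endomorphism of `σ.extension` preserving `X`. -/
noncomputable def actQuot : σ.triangularEnd.carrier →ₐ[K] Module.End K Y.carrier :=
  AlgHom.ofLinearMap
    (LinearMap.llcomp K _ _ _ σ.snd ∘ₗ LinearMap.lcomp K _ σ.inr ∘ₗ σ.act.toLinearMap)
    (by
      change σ.snd ∘ₗ σ.act 1 ∘ₗ σ.inr = LinearMap.id
      rw [map_one]
      exact σ.snd_comp_inr)
    fun a b => by
      change σ.snd ∘ₗ σ.act (a * b) ∘ₗ σ.inr =
        (σ.snd ∘ₗ σ.act a ∘ₗ σ.inr) ∘ₗ σ.snd ∘ₗ σ.act b ∘ₗ σ.inr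
      rw [← LinearMap.comp_assoc _ σ.snd, ← σ.snd_comp_eq (snd_comp_act_comp_inl a), map_mul]
      rfl

/-- The diagonal entry in `End_K(X)` of an endomorphism of `σ.extension` preserving `X`. -/
noncomputable def actSub : σ.triangularEnd.carrier →ₐ[K] Module.End K X.carrier :=
  AlgHom.ofLinearMap
    (LinearMap.llcomp K _ _ _ σ.fst ∘ₗ LinearMap.lcomp K _ σ.inl ∘ₗ σ.act.toLinearMap)
    (by
      change σ.fst ∘ₗ σ.act 1 ∘ₗ σ.inl = LinearMap.id
      rw [map_one]
      exact σ.fst_comp_inl)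
    fun a b => by
      change σ.fst ∘ₗ σ.act (a * b) ∘ₗ σ.inl =
        σ.fst ∘ₗ σ.act a ∘ₗ σ.inl ∘ₗ σ.fst ∘ₗ σ.act b ∘ₗ σ.inl
      rw [← σ.comp_inl_eq (snd_comp_act_comp_inl b), map_mul]
      rfl

theorem actQuot_apply (b : σ.triangularEnd.carrier) :
    σ.actQuot b = σ.snd ∘ₗ σ.act b ∘ₗ σ.inr := rfl

theorem actSub_apply (b : σ.triangularEnd.carrier) :
    σ.actSub b = σ.fst ∘ₗ σ.act b ∘ₗ σ.inl := rfl

theorem snd_comp_act (b : σ.triangularEnd.carrier) :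
    σ.snd ∘ₗ σ.act b = σ.actQuot b ∘ₗ σ.snd :=
  σ.snd_comp_eq (snd_comp_act_comp_inl b)

theorem act_comp_inl (b : σ.triangularEnd.carrier) :
    σ.act b ∘ₗ σ.inl = σ.inl ∘ₗ σ.actSub b :=
  σ.comp_inl_eq (snd_comp_act_comp_inl b)

theorem actQuot_mem_homDeg {i : ℤ} {b : σ.triangularEnd.carrier}
    (hb : b ∈ σ.triangularEnd.grading i) : σ.actQuot b ∈ homDeg Y Y i := by
  have h := comp_mem_homDeg σ.snd_mem_homDeg
    (comp_mem_homDeg (σ.act_mem_homDeg hb) σ.inr_mem_homDeg)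
  rwa [add_zero, zero_add] at h

theorem actSub_mem_homDeg {i : ℤ} {b : σ.triangularEnd.carrier}
    (hb : b ∈ σ.triangularEnd.grading i) : σ.actSub b ∈ homDeg X X i := by
  have h := comp_mem_homDeg σ.fst_mem_homDeg
    (comp_mem_homDeg (σ.act_mem_homDeg hb) σ.inl_mem_homDeg)
  rwa [add_zero, zero_add] at h

theorem actQuot_d (b : σ.triangularEnd.carrier) :
    σ.actQuot (σ.triangularEnd.d b) = homD Y Y (σ.actQuot b) := by
  have h : σ.snd ∘ₗ signConj _ _ (σ.act b) ∘ₗ σ.inl = 0 := by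
    rw [← signConj_of_mem_zero σ.snd_mem_homDeg, ← signConj_of_mem_zero σ.inl_mem_homDeg,
      ← signConj_comp, ← signConj_comp, snd_comp_act_comp_inl, map_zero]
  calc σ.actQuot (σ.triangularEnd.d b)
      = σ.snd ∘ₗ homD _ _ (σ.act b) ∘ₗ σ.inr := by rw [actQuot_apply, act_d]
    _ = σ.snd ∘ₗ homD _ _ (σ.act b) ∘ₗ σ.inr +
          (σ.snd ∘ₗ signConj _ _ (σ.act b) ∘ₗ σ.inl) ∘ₗ σ.toLinearMap := by
        rw [h, LinearMap.zero_comp, add_zero]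
    _ = homD Y Y (σ.actQuot b) := by
        rw [actQuot_apply, homD_comp_eq, homD_comp_eq, homD_snd, homD_inr,
          signConj_of_mem_zero σ.snd_mem_homDeg, LinearMap.zero_comp, zero_add,
          LinearMap.comp_add]
        rfl

theorem actSub_d (b : σ.triangularEnd.carrier) :
    σ.actSub (σ.triangularEnd.d b) = homD X X (σ.actSub b) := by
  rw [actSub_apply, actSub_apply, act_d, homD_comp_eq, homD_comp_eq, homD_fst, homD_inl,
    signConj_of_mem_zero σ.fst_mem_homDeg, LinearMap.comp_zero, add_zero, LinearMap.neg_comp,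
    LinearMap.comp_assoc, snd_comp_act_comp_inl, LinearMap.comp_zero, neg_zero, zero_add]

/-- The homomorphism of DG algebras from the endomorphisms of `σ.extension` preserving `X` to
those of the quotient `Y`. -/
noncomputable def toEndQuot : DGAlgebra.Hom σ.triangularEnd Y.endAlgebra :=
  homEndAlgebra σ.actQuot (fun _ _ hb => σ.actQuot_mem_homDeg hb) σ.actQuot_d

/-- The homomorphism of DG algebras from the endomorphisms of `σ.extension` preserving `X` to
those of `X`. -/
noncomputable def toEndSub : DGAlgebra.Hom σ.triangularEnd X.endAlgebra :=
  homEndAlgebra σ.actSub (fun _ _ hb => σ.actSub_mem_homDeg hb) σ.actSub_d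

theorem toEndQuot_isQuasiIso (h : (homComplex σ.extension X).IsAcyclic) :
    σ.toEndQuot.IsQuasiIso := by
  refine homEndAlgebra_isQuasiIso (fun f hf => ?_) fun b hb hb0 => ?_
  · obtain ⟨b, hbf⟩ := σ.exists_act_eq (f := σ.inr ∘ₗ f ∘ₗ σ.snd)
      (comp_mem_homTotal (mem_homTotal σ.inr_mem_homDeg)
        (comp_mem_homTotal hf (mem_homTotal σ.snd_mem_homDeg)))
      (by rw [LinearMap.comp_assoc, LinearMap.comp_assoc, snd_comp_inl, LinearMap.comp_zero,
        LinearMap.comp_zero, LinearMap.comp_zero])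
    exact ⟨b, by rw [actQuot_apply, hbf]; rfl⟩
  · obtain ⟨k, hk, hkb⟩ := σ.exists_homD_inl_comp_eq h (σ.act_mem_homTotal b)
      (by rw [← act_d, hb, map_zero]) (by rw [snd_comp_act, hb0, LinearMap.zero_comp])
    obtain ⟨c, hc⟩ := σ.exists_act_eq
      (comp_mem_homTotal (mem_homTotal σ.inl_mem_homDeg) hk)
      (by rw [LinearMap.comp_assoc, ← LinearMap.comp_assoc _ σ.inl, snd_comp_inl,
        LinearMap.zero_comp])
    refine ⟨c, ?_, σ.act_injective (by rw [act_d, hc, hkb])⟩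
    rw [actQuot_apply, hc, LinearMap.comp_assoc, ← LinearMap.comp_assoc _ σ.inl, snd_comp_inl,
      LinearMap.zero_comp]

theorem toEndSub_isQuasiIso (h : (homComplex Y σ.extension).IsAcyclic) :
    σ.toEndSub.IsQuasiIso := by
  refine homEndAlgebra_isQuasiIso (fun f hf => ?_) fun b hb hb0 => ?_
  · obtain ⟨b, hbf⟩ := σ.exists_act_eq (f := σ.inl ∘ₗ f ∘ₗ σ.fst)
      (comp_mem_homTotal (mem_homTotal σ.inl_mem_homDeg)
        (comp_mem_homTotal hf (mem_homTotal σ.fst_mem_homDeg)))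
      (by rw [LinearMap.comp_assoc, ← LinearMap.comp_assoc _ σ.inl, snd_comp_inl,
        LinearMap.zero_comp])
    exact ⟨b, by rw [actSub_apply, hbf]; rfl⟩
  · obtain ⟨k, hk, hkb⟩ := σ.exists_homD_comp_snd_eq h (σ.act_mem_homTotal b)
      (by rw [← act_d, hb, map_zero]) (by rw [act_comp_inl, hb0, LinearMap.comp_zero])
    obtain ⟨c, hc⟩ := σ.exists_act_eq
      (comp_mem_homTotal hk (mem_homTotal σ.snd_mem_homDeg))
      (by rw [LinearMap.comp_assoc, snd_comp_inl, LinearMap.comp_zero, LinearMap.comp_zero])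
    refine ⟨c, ?_, σ.act_injective (by rw [act_d, hc, hkb])⟩
    rw [actSub_apply, hc, LinearMap.comp_assoc, snd_comp_inl, LinearMap.comp_zero,
      LinearMap.comp_zero]

end ExtClass

namespace ExtClass

variable {Y Z : DGModule.{u, v, w} A} (σ : ExtClass Y Z.desusp)

/-- The homomorphism of DG algebras from the endomorphisms of `σ.extension` preserving `Z[-1]` to
those of `Z`. -/
noncomputable def toEndOfDesusp : DGAlgebra.Hom σ.triangularEnd Z.endAlgebra :=
  Z.desuspEnd.comp σ.toEndSub

theorem toEndOfDesusp_isQuasiIso (h : (homComplex Y σ.extension).IsAcyclic) :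
    σ.toEndOfDesusp.IsQuasiIso :=
  Z.desuspEnd_isQuasiIso.comp (σ.toEndSub_isQuasiIso h)

theorem act_comp_inl_comp_toDesusp {i : ℤ} {b : σ.triangularEnd.carrier}
    (hb : b ∈ σ.triangularEnd.grading i) :
    σ.inl ∘ₗ Z.toDesusp ∘ₗ Z.endVal (σ.toEndOfDesusp.toAlgHom b) =
      i.negOnePow • (σ.act b ∘ₗ σ.inl ∘ₗ Z.toDesusp) :=
  calc σ.inl ∘ₗ Z.toDesusp ∘ₗ Z.endVal (σ.toEndOfDesusp.toAlgHom b)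
      = σ.inl ∘ₗ signConj _ _ (σ.actSub b) ∘ₗ Z.toDesusp := rfl
    _ = i.negOnePow • ((σ.inl ∘ₗ σ.actSub b) ∘ₗ Z.toDesusp) := by
        rw [signConj_of_mem (σ.actSub_mem_homDeg hb)]
        exact LinearMap.ext fun z => map_negOnePow_smul σ.inl i _
    _ = i.negOnePow • (σ.act b ∘ₗ σ.inl ∘ₗ Z.toDesusp) := by rw [← σ.act_comp_inl]; rfl

/-- The composite `Z → Z[-1] → Z[-1] ⊕ Y` as an extension class of DG modules over the
endomorphisms of `σ.extension` preserving `Z[-1]`. -/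
noncomputable def desuspClass : ExtClass (restrict σ.toEndOfDesusp Z.overEnd)
    (restrict σ.triangularEndVal σ.extension.overEnd) where
  toLinearMap := σ.inl ∘ₗ Z.toDesusp
  mem_homDeg := ⟨(comp_mem_homDeg σ.inl_mem_homDeg Z.toDesusp_mem_homDeg).1,
    fun j b z hb => (LinearMap.congr_fun (σ.act_comp_inl_comp_toDesusp hb) z).trans <| by
      rw [one_mul]; rfl⟩
  homD_eq_zero := by
    have h : homD Z σ.extension (σ.inl ∘ₗ Z.toDesusp) = 0 := by
      rw [homD_comp_eq, homD_inl, homD_toDesusp, LinearMap.zero_comp, LinearMap.comp_zero, add_zero]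
    exact h

/-- The projection `(Z[-1] ⊕ Y) ⊕ Z → Y`. -/
noncomputable def toQuot : Hom σ.desuspClass.extension (restrict σ.toEndQuot Y.overEnd) where
  toFun m := σ.snd (σ.desuspClass.fst m)
  map_add' m n := map_add (σ.snd ∘ₗ σ.desuspClass.fst) m n
  map_smul' b m := LinearMap.congr_fun (σ.snd_comp_act b) (σ.desuspClass.fst m)
  map_mem _ _ hm := hm.1.2
  map_d m := add_zero (Y.d (σ.snd (σ.desuspClass.fst m)))

theorem toQuot_isQuasiIso : σ.toQuot.IsQuasiIso := by
  refine Hom.isQuasiIso_of_surjective (fun y => ⟨((0, y), 0), rfl⟩) ?_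
  rintro ⟨⟨x, y⟩, (z : Z.carrier)⟩ hd (rfl : y = 0)
  have hz : Z.d (Z.ofDesusp x) = z := by
    have h : -Z.d (Z.ofDesusp x) + Z.ofDesusp (σ.toLinearMap 0) + z = 0 :=
      congrArg (fun m => Z.ofDesusp m.1.1) hd
    rwa [map_zero, map_zero, add_zero, neg_add_eq_zero] at h
  have hx : σ.extension.d 0 + σ.inl x = σ.inl x := by rw [map_zero, zero_add]
  exact ⟨(0, Z.ofDesusp x), rfl, Prod.ext hx hz⟩

end ExtClass

end DGModule

theorem proposition1p3 {K : Type u} [CommRing K] (A : DGAlgebra.{u, v} K)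
    (M P P' : DGModule.{u, v, w} A)
    (p : DGModule.Hom P M) (p' : DGModule.Hom P' M)
    (hP : P.IsKProjective) (hp : p.IsQuasiIso)
    (hP' : P'.IsKProjective) (hp' : p'.IsQuasiIso) :
    ∃ (B'' : DGAlgebra.{u, w} K) (P'' : DGModule.{u, w, w} B'')
      (f : DGAlgebra.Hom B'' P.endAlgebra) (f' : DGAlgebra.Hom B'' P'.endAlgebra)
      (g : DGModule.Hom P'' (DGModule.restrict f P.overEnd))
      (g' : DGModule.Hom P'' (DGModule.restrict f' P'.overEnd)),
      f.IsQuasiIso ∧ f'.IsQuasiIso ∧ g.IsQuasiIso ∧ g'.IsQuasiIso := by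
  obtain ⟨φ, hφ⟩ := DGModule.exists_isQuasiIso_of_isKProjective hP hp hp'
  let σ : DGModule.ExtClass P P'.desusp := φ.coconeClass
  have hC₀ : σ.extension.toDGComplex.IsAcyclic := hφ.cocone_isAcyclic
  have hC : σ.extension.IsKProjective := hP'.desusp.extension hP σ
  exact ⟨σ.triangularEnd, σ.desuspClass.extension, σ.toEndQuot, σ.toEndOfDesusp, σ.toQuot,
    σ.desuspClass.proj, σ.toEndQuot_isQuasiIso (hC.homComplex_isAcyclic_of_isAcyclic hC₀ _),
    σ.toEndOfDesusp_isQuasiIso (hP _ hC₀), σ.toQuot_isQuasiIso, σ.desuspClass.proj_isQuasiIso hC₀⟩
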